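/- For $n\ge 0$ let $\phi_n=(-1)^n/\Gamma(n+1)$. Let $\beta,\kappa\in\mathbb R\setminus\{0\}$, $b>0$, $c,\delta\in\mathbb R$, $\alpha\in\mathbb C$, and let $\gamma$ be the vertical line $\operatorname{Re}s=c$, oriented upwards, with $\int_\gamma=\lim_{T\to\infty}\int_{c-iT}^{c+iT}$. Assume the following. (a) $F$ is holomorphic in the half-plane $\operatorname{Re}u>-\delta$ and there are real constants $C,P,A$ with $A<\pi$ such that $|F(u)/\Gamma(u+1)|\le C e^{P\operatorname{Re}u+A|\operatorname{Im}u|}$ there, where $1/\Gamma$ is the entire reciprocal gamma function (Hardy's conditions for Ramanujan's Master Theorem). (b) $f:(0,\infty)\to\mathbb C$ is real-analytic and has the expansion $$f(x)=\sum_{n\ge0}\phi_nF(n)x^{\beta n}$$ for all $x>0$ for which $x^\beta$ is sufficiently small. (c) $s\mapsto\varphi(s)$ is locally integrable on $\gamma$, and for every $x>0$ $$g(x)=\frac1{2\pi i}\int_\gamma\varphi(s)x^{-\kappa s}\,ds ,$$ where the integral converges (possibly conditionally) and the truncated integrals $\frac{1}{2\pi i}\int_{c-iT}^{c+iT}\varphi(s)x^{-\kappa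 s}\,ds$, $T\ge0$, are bounded uniformly for $x$ in compact subsets of $(0,\infty)$. (d) $0<\operatorname{Re}\dfrac{\alpha-\kappa s}{\beta}<\delta$ for $s\in\gamma$, that is, $0<(\operatorname{Re}\alpha-\kappa c)/\beta<\delta$. Then the integral $$J=\frac1{2\pi i}\int_\gamma\varphi(s)\,\Gamma\!\left(\frac{\alpha-\kappa s}{\beta}\right)F\!\left(\frac{\kappa s-\alpha}{\beta}\right)b^{-\kappa s}\,ds$$ converges, and whenever the integral on the left of the following identity converges (as an improper integral at $0$ and at $\infty$), one has $$\int_0^\infty x^{\alpha-1}f(x)\,g(bx)\,dx=\frac1{|\beta|}\,\frac1{2\pi i}\int_\gamma\varphi(s)\,\Gamma\!\left(\frac{\alpha-\kappa s}{\beta}\right)F\!\left(\frac{\kappa s-\alpha}{\beta}\right)b^{-\kappa s}\,ds .$$ If moreover $\varphi$ is absolutely integrable on $\gamma$, then both integrals in this identity converge absolutely, and the identity holds. -/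

import Mathlib

open Set Filter Topology MeasureTheory

noncomputable section

/-- The indicator `φ_n = (-1)^n / Γ(n+1)` attached to the index `n`. -/
def bracketIndicator (n : ℕ) : ℂ := (-1) ^ n / Complex.Gamma ((n : ℂ) + 1)

/-- The truncated line integral `(1 / 2πi) ∫ h(s) ds` over the segment from `c - iT` to `c + iT`,
parametrised by `s = c + i t`, `ds = i dt`. -/
def truncLineIntegral (c : ℝ) (h : ℂ → ℂ) (T : ℝ) : ℂ :=
  1 / (2 * (Real.pi : ℂ) * Complex.I) *
    ∫ t in (-T)..T, h ((c : ℂ) + (t : ℂ) * Complex.I) * Complex.I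

/-- `(1 / 2πi) ∫_γ h(s) ds` converges to `J`, where `γ` is the vertical line `Re s = c`, oriented
upwards. Convergence is the usual one, `∫_γ = lim_{T → ∞} ∫_{c - iT}^{c + iT}`. -/
def HasLineIntegral (c : ℝ) (h : ℂ → ℂ) (J : ℂ) : Prop :=
  LocallyIntegrable (fun t : ℝ => h ((c : ℂ) + (t : ℂ) * Complex.I)) ∧
    Tendsto (truncLineIntegral c h) atTop (𝓝 J)

/-- The (possibly improper) integral `∫_0^∞ h(x) dx` converges to `L`: the integrals of `h` over
`[p, q]` tend to `L` as `p → 0+` and `q → ∞` independently. -/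
def HasHalfLineIntegral (h : ℝ → ℂ) (L : ℂ) : Prop :=
  LocallyIntegrableOn h (Ioi 0) ∧
    Tendsto (fun p : ℝ × ℝ => ∫ x in p.1..p.2, h x) (𝓝[>] (0 : ℝ) ×ˢ atTop) (𝓝 L)

/-- Hardy's class of coefficient functions for Ramanujan's master theorem: `F` is holomorphic for
`Re u > -δ` and `F(u) / Γ(u + 1)` is `O(exp (P Re u + A |Im u|))` there, for some `P` and some
`A < π`. (At a pole of `Γ(u + 1)` the value of `F(u) / Γ(u + 1)` below is `0`, which is the
correct value of `F(u) * (1 / Γ)(u + 1)`.) -/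
def IsHardyClass (δ : ℝ) (F : ℂ → ℂ) : Prop :=
  DifferentiableOn ℂ F {u : ℂ | -δ < u.re} ∧
    ∃ C P A : ℝ, A < Real.pi ∧ ∀ u : ℂ, -δ < u.re →
      ‖F u / Complex.Gamma (u + 1)‖ ≤ C * Real.exp (P * u.re + A * |u.im|)

/-- `f(x) = ∑_n φ_n F(n) x^{β n}` on `(0, ∞)`: `f` is real-analytic on `(0, ∞)` and equals the sum
of the series at all `x > 0` with `x ^ β` small enough (elsewhere `f` is the analytic continuation,
as for `1 / (x ^ 2 + k ^ 2)`). -/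
def HasIndicatorExpansion (f : ℝ → ℂ) (F : ℂ → ℂ) (β : ℝ) : Prop :=
  AnalyticOnNhd ℝ f (Ioi 0) ∧
    ∃ ρ : ℝ, 0 < ρ ∧ ∀ x : ℝ, 0 < x → x ^ β < ρ →
      HasSum (fun n : ℕ => bracketIndicator n * F (n : ℂ) * ((x ^ (β * n) : ℝ) : ℂ)) (f x)

/-- `g(x) = (1 / 2πi) ∫_γ φ(s) x^{-κ s} ds` for all `x > 0`, where `γ` is the line `Re s = c`: the
line integral converges (conditional convergence is allowed), with truncated integrals that are
bounded uniformly for `x` in compact subsets of `(0, ∞)`. -/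
def IsScaledInverseMellin (g : ℝ → ℂ) (φ : ℂ → ℂ) (κ c : ℝ) : Prop :=
  (∀ x : ℝ, 0 < x → HasLineIntegral c (fun s => φ s * (x : ℂ) ^ (-((κ : ℂ) * s))) (g x)) ∧
    ∀ p q : ℝ, 0 < p → ∃ B : ℝ, ∀ x ∈ Icc p q, ∀ T : ℝ, 0 ≤ T →
      ‖truncLineIntegral c (fun s => φ s * (x : ℂ) ^ (-((κ : ℂ) * s))) T‖ ≤ B

end

/-! ### Integration by parts and growth of primitives -/

/-- Integration by parts against a function that is merely integrable. -/
theorem integral_mul_eq_of_hasDerivAt {h K K' : ℝ → ℂ} {a b : ℝ} (hab : a ≤ b)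
    (hh : IntervalIntegrable h volume a b) (hK : ∀ t ∈ Icc a b, HasDerivAt K (K' t) t)
    (hK' : ContinuousOn K' (Icc a b)) :
    ∫ t in a..b, h t * K t =
      (∫ t in a..b, h t) * K b - ∫ τ in a..b, (∫ t in a..τ, h t) * K' τ := by
  have hi : IntegrableOn h (Ioc a b) := (intervalIntegrable_iff_integrableOn_Ioc_of_le hab).1 hh
  have hi' : IntegrableOn K' (Ioc a b) := hK'.integrableOn_Icc.mono_set Ioc_subset_Icc_self
  have hKc : ContinuousOn K (Icc a b) := fun t ht => (hK t ht).continuousAt.continuousWithinAt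
  -- The primitive of h need not be differentiable everywhere, so the product rule is avoided: K b -
  -- K t is written as the integral of K' over [t, b], and Fubini is applied on the triangle t < τ.
  have hint : Integrable (fun p : ℝ × ℝ => {p : ℝ × ℝ | p.1 < p.2}.indicator
      (fun p => h p.1 * K' p.2) p)
      ((volume.restrict (Ioc a b)).prod (volume.restrict (Ioc a b))) :=
    (Integrable.mul_prod hi hi').indicator (measurableSet_lt measurable_fst measurable_snd)
  have key := integral_integral_swap
    (f := fun t τ => {p : ℝ × ℝ | p.1 < p.2}.indicator (fun p => h p.1 * K' p.2) (t, τ)) hint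
  have e1 : ∀ t ∈ Ioc a b, ∫ τ in Ioc a b,
      {p : ℝ × ℝ | p.1 < p.2}.indicator (fun p => h p.1 * K' p.2) (t, τ) =
      h t * (K b - K t) := by
    intro t ht
    have : (fun τ => {p : ℝ × ℝ | p.1 < p.2}.indicator (fun p => h p.1 * K' p.2) (t, τ)) =
        (Ioi t).indicator (fun τ => h t * K' τ) := by
      ext τ; simp [indicator]
    rw [this, setIntegral_indicator measurableSet_Ioi]
    have : Ioc a b ∩ Ioi t = Ioc t b := by
      ext x; simp only [mem_inter_iff, mem_Ioc, mem_Ioi]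
      constructor
      · rintro ⟨⟨_, h2⟩, h3⟩; exact ⟨h3, h2⟩
      · rintro ⟨h3, h2⟩; exact ⟨⟨ht.1.trans h3, h2⟩, h3⟩
    rw [this, ← intervalIntegral.integral_of_le ht.2, intervalIntegral.integral_const_mul]
    congr 1
    have hs : uIcc t b ⊆ Icc a b := by
      rw [uIcc_of_le ht.2]; exact Icc_subset_Icc ht.1.le le_rfl
    exact intervalIntegral.integral_eq_sub_of_hasDerivAt (fun x hx => hK x (hs hx))
      ((hK'.mono hs).intervalIntegrable)
  have e2 : ∀ τ ∈ Ioc a b, ∫ t in Ioc a b,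
      {p : ℝ × ℝ | p.1 < p.2}.indicator (fun p => h p.1 * K' p.2) (t, τ) =
      (∫ t in a..τ, h t) * K' τ := by
    intro τ hτ
    have : (fun t => {p : ℝ × ℝ | p.1 < p.2}.indicator (fun p => h p.1 * K' p.2) (t, τ)) =
        (Iio τ).indicator (fun t => h t * K' τ) := by
      ext t; simp [indicator]
    rw [this, setIntegral_indicator measurableSet_Iio]
    have : Ioc a b ∩ Iio τ = Ioo a τ := by
      ext x; simp only [mem_inter_iff, mem_Ioc, mem_Iio, mem_Ioo]
      constructor
      · rintro ⟨⟨h1, h2⟩, h3⟩; exact ⟨h1, h3⟩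
      · rintro ⟨h3, h2⟩; exact ⟨⟨h3, h2.le.trans hτ.2⟩, h2⟩
    rw [this, ← integral_Ioc_eq_integral_Ioo, ← intervalIntegral.integral_of_le hτ.1.le,
      intervalIntegral.integral_mul_const]
  rw [setIntegral_congr_fun measurableSet_Ioc e1, setIntegral_congr_fun measurableSet_Ioc e2,
    ← intervalIntegral.integral_of_le hab, ← intervalIntegral.integral_of_le hab] at key
  rw [← key]
  have hm : IntervalIntegrable (fun t => h t * K t) volume a b :=
    hh.mul_continuousOn (by rwa [uIcc_of_le hab])
  have : ∀ t, h t * (K b - K t) = h t * K b - h t * K t := fun t => by ring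
  simp_rw [this]
  rw [intervalIntegral.integral_sub (hh.mul_const _) hm, intervalIntegral.integral_mul_const]
  ring

/-- A locally integrable function, times a kernel of class `C¹` whose derivative decays, has
convergent one-sided integrals, provided its primitive grows slowly. -/
theorem tendsto_integral_mul_of_primitive_bound {h K K' : ℝ → ℂ} {C D : ℝ}
    (hh : LocallyIntegrable h) (hK : ∀ t, HasDerivAt K (K' t) t) (hK' : Continuous K')
    (hb : ∀ t, 0 ≤ t → ‖∫ u in (0 : ℝ)..t, h u‖ ≤ C * (1 + t ^ 2))
    (hd : ∀ t, ‖K t‖ ≤ D * ((1 + t ^ 2) ^ 2)⁻¹) (hd' : ∀ t, ‖K' t‖ ≤ D * ((1 + t ^ 2) ^ 2)⁻¹) :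
    Tendsto (fun T => ∫ t in (0 : ℝ)..T, h t * K t) atTop
      (𝓝 (-∫ t in Ioi (0 : ℝ), (∫ u in (0 : ℝ)..t, h u) * K' t)) := by
  have hii : ∀ a b, IntervalIntegrable h volume a b := fun a b =>
    (hh.integrableOn_isCompact isCompact_uIcc).intervalIntegrable
  have hP : Continuous (fun t => ∫ u in (0 : ℝ)..t, h u) :=
    intervalIntegral.continuous_primitive hii 0
  have hC : 0 ≤ C := by simpa using (norm_nonneg _).trans (hb 0 le_rfl)
  have hbd : ∀ (k : ℝ → ℂ), (∀ t, ‖k t‖ ≤ D * ((1 + t ^ 2) ^ 2)⁻¹) → ∀ t, 0 ≤ t →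
      ‖(∫ u in (0 : ℝ)..t, h u) * k t‖ ≤ C * D * (1 + t ^ 2)⁻¹ := by
    intro k hk t ht
    rw [norm_mul]
    have h1 : (0:ℝ) < 1 + t ^ 2 := by positivity
    calc _ ≤ (C * (1 + t ^ 2)) * (D * ((1 + t ^ 2) ^ 2)⁻¹) := by
          gcongr
          · exact hb t ht
          · exact hk t
      _ = _ := by field_simp
  have hI : IntegrableOn (fun t => (∫ u in (0 : ℝ)..t, h u) * K' t) (Ioi 0) := by
    refine Integrable.mono' ((integrable_inv_one_add_sq.const_mul (C * D)).integrableOn)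
      (hP.mul hK').aestronglyMeasurable ?_
    filter_upwards [ae_restrict_mem measurableSet_Ioi] with t ht
    exact hbd K' hd' t (le_of_lt ht)
  have h0 : Tendsto (fun T => (∫ u in (0 : ℝ)..T, h u) * K T) atTop (𝓝 0) := by
    refine squeeze_zero_norm' (a := fun t => C * D * (1 + t ^ 2)⁻¹)
      ((eventually_ge_atTop 0).mono fun t ht => hbd K hd t ht) ?_
    have : Tendsto (fun t : ℝ => 1 + t ^ 2) atTop atTop :=
      tendsto_atTop_add_const_left _ _ (tendsto_pow_atTop two_ne_zero)
    simpa using (tendsto_inv_atTop_zero.comp this).const_mul (C * D)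
  have := h0.sub (intervalIntegral_tendsto_integral_Ioi 0 hI tendsto_id)
  rw [zero_sub] at this
  refine this.congr' ?_
  filter_upwards [eventually_ge_atTop 0] with T hT
  exact (integral_mul_eq_of_hasDerivAt hT (hii _ _) (fun t _ => hK t) hK'.continuousOn).symm

/-- Integration by parts moves the burden to m and m'. The interval starts at 1 because the intended
multiplier 1/sin(2θt) is singular at 0; passing from primitives based at 0 to primitives based at 1
costs the factor 2. -/
theorem norm_integral_mul_le_of_primitive_bound {u m m' : ℝ → ℂ} {B M M' T : ℝ} (hT : 1 ≤ T)
    (hu : ∀ a b, IntervalIntegrable u volume a b)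
    (hB : ∀ t, 0 ≤ t → ‖∫ x in (0 : ℝ)..t, u x‖ ≤ B)
    (hm : ∀ t ∈ Icc 1 T, HasDerivAt m (m' t) t) (hm' : ContinuousOn m' (Icc 1 T))
    (hM : ‖m T‖ ≤ M) (hM' : ∀ t ∈ Icc 1 T, ‖m' t‖ ≤ M') :
    ‖∫ t in (1 : ℝ)..T, u t * m t‖ ≤ 2 * B * M + 2 * B * M' * (T - 1) := by
  have hB0 : 0 ≤ B := (norm_nonneg _).trans (hB 0 le_rfl)
  have hV : ∀ t, 1 ≤ t → ‖∫ x in (1 : ℝ)..t, u x‖ ≤ 2 * B := by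
    intro t ht
    rw [← intervalIntegral.integral_interval_sub_left (hu 0 t) (hu 0 1)]
    have := norm_sub_le (∫ x in (0 : ℝ)..t, u x) (∫ x in (0 : ℝ)..1, u x)
    linarith [hB t (by linarith), hB 1 zero_le_one]
  rw [integral_mul_eq_of_hasDerivAt hT (hu _ _) hm hm']
  refine (norm_sub_le _ _).trans (add_le_add ?_ ?_)
  · rw [norm_mul]
    exact mul_le_mul (hV T hT) hM (norm_nonneg _) (by positivity)
  · have := intervalIntegral.norm_integral_le_of_norm_le_const (a := 1) (b := T) (C := 2 * B * M')
      (f := fun τ => (∫ t in (1 : ℝ)..τ, u t) * m' τ) ?_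
    · rwa [abs_of_nonneg (by linarith)] at this
    · intro t ht
      rw [uIoc_of_le hT] at ht
      rw [norm_mul]
      exact mul_le_mul (hV t ht.1.le) (hM' t ⟨ht.1.le, ht.2⟩) (norm_nonneg _) (by positivity)

theorem hasDerivAt_cexp_div_sin (a θ t : ℝ) (h : Real.sin (2 * θ * t) ≠ 0) :
    HasDerivAt (fun t : ℝ => Complex.exp ((a * t : ℝ) * Complex.I) *
        (((Real.sin (2 * θ * t))⁻¹ : ℝ) : ℂ))
      (Complex.exp ((a * t : ℝ) * Complex.I) * (a * Complex.I) *
        (((Real.sin (2 * θ * t))⁻¹ : ℝ) : ℂ) +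
      Complex.exp ((a * t : ℝ) * Complex.I) *
        ((-(Real.cos (2 * θ * t) * (2 * θ)) / (Real.sin (2 * θ * t)) ^ 2 : ℝ) : ℂ)) t := by
  have h1 : HasDerivAt (fun t : ℝ => Complex.exp ((a * t : ℝ) * Complex.I))
      (Complex.exp ((a * t : ℝ) * Complex.I) * (a * Complex.I)) t := by
    have := (((hasDerivAt_id t).const_mul a).ofReal_comp.mul_const Complex.I).cexp
    simpa using this
  have h2 : HasDerivAt (fun t : ℝ => Real.sin (2 * θ * t)) (Real.cos (2 * θ * t) * (2 * θ)) t := by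
    simpa using ((hasDerivAt_id t).const_mul (2 * θ)).sin
  exact h1.mul (h2.inv h).ofReal_comp

/-- If the symmetric Fourier truncations of `h` are bounded uniformly for small frequencies, then
the primitive of `h` grows at most quadratically. -/
theorem exists_primitive_bound {h : ℝ → ℂ} {B : ℝ} (hh : LocallyIntegrable h)
    (hB : ∀ θ : ℝ, |θ| ≤ 1 → ∀ T : ℝ, 0 ≤ T →
      ‖∫ t in (-T)..T, h t * Complex.exp ((-θ * t : ℝ) * Complex.I)‖ ≤ B) :
    ∃ C, ∀ t, 0 ≤ t → ‖∫ x in (0 : ℝ)..t, h x‖ ≤ C * (1 + t ^ 2) := by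
  have hii : ∀ a b, IntervalIntegrable h volume a b := fun a b =>
    (hh.integrableOn_isCompact isCompact_uIcc).intervalIntegrable
  have hB0 : 0 ≤ B := (norm_nonneg _).trans (hB 0 (by simp) 0 le_rfl)
  have hni : ∀ a b, IntervalIntegrable (fun t => h (-t)) volume a b := fun a b => by
    simpa using (hii (-a) (-b)).comp_sub_left 0
  set e : ℝ → ℝ → ℂ := fun θ t => Complex.exp ((θ * t : ℝ) * Complex.I) with he
  have hec : ∀ θ, Continuous (e θ) := fun θ => by simp only [he]; fun_prop
  -- Symmetric truncations see h only through this folded combination of h(t) and h(-t). Two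
  -- frequencies, θ and -θ, are needed to separate the two values.
  set u : ℝ → ℝ → ℂ := fun θ t => h t * e (-θ) t + h (-t) * e θ t with hu
  have hui : ∀ θ a b, IntervalIntegrable (u θ) volume a b := fun θ a b =>
    ((hii a b).mul_continuousOn (hec _).continuousOn).add
      ((hni a b).mul_continuousOn (hec _).continuousOn)
  have huB : ∀ θ, |θ| ≤ 1 → ∀ t, 0 ≤ t → ‖∫ x in (0 : ℝ)..t, u θ x‖ ≤ B := by
    intro θ hθ t ht
    have hb := hB θ hθ t ht
    have hi : ∀ a b, IntervalIntegrable
        (fun t => h t * Complex.exp ((-θ * t : ℝ) * Complex.I)) volume a b := fun a b =>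
      (hii a b).mul_continuousOn (hec (-θ)).continuousOn
    rw [← intervalIntegral.integral_add_adjacent_intervals (hi (-t) 0) (hi 0 t)] at hb
    have e1 : ∫ x in (0 : ℝ)..t, h (-x) * e θ x =
        ∫ x in (-t)..0, h x * Complex.exp ((-θ * x : ℝ) * Complex.I) := by
      have := intervalIntegral.integral_comp_neg (a := 0) (b := t)
        (fun x => h x * Complex.exp ((-θ * x : ℝ) * Complex.I))
      rw [neg_zero] at this
      rw [← this]
      simp [he]
    have e2 : ∫ x in (0 : ℝ)..t, u θ x = (∫ x in (0 : ℝ)..t, h x * e (-θ) x) +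
        ∫ x in (0 : ℝ)..t, h (-x) * e θ x :=
      intervalIntegral.integral_add ((hii 0 t).mul_continuousOn (hec _).continuousOn)
        ((hni 0 t).mul_continuousOn (hec _).continuousOn)
    rw [e2, e1, add_comm]
    exact hb
  have hpi4 := Real.pi_le_four
  have hsmall : ∀ t, 0 ≤ t → t ≤ 1 → ‖∫ x in (0 : ℝ)..t, h x‖ ≤ ∫ x in (0 : ℝ)..1, ‖h x‖ := by
    intro t h0 h1
    refine (intervalIntegral.norm_integral_le_integral_norm h0).trans ?_
    exact intervalIntegral.integral_mono_interval le_rfl h0 h1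
      (Eventually.of_forall fun _ => norm_nonneg _) (hii 0 1).norm
  have hbig : ∀ T, 1 ≤ T → ‖∫ x in (1 : ℝ)..T, h x‖ ≤ 2 * B + 4 * B * (1 + T) * T := by
    intro T hT
    have hT0 : 0 < T := by linarith
    -- With this θ the angle 2θt stays in (0, π/2] on [1, T], so Jordan's inequality gives sin(2θt)
    -- ≥ t/T ≥ 1/T. At t = T the sine equals 1, so the boundary term costs only M = 1. The
    -- derivative of the multiplier is at most θT + 2θT² ≤ 1 + 2T, which produces the quadratic
    -- growth.
    set θ := Real.pi / (4 * T) with hθ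
    have hθ0 : 0 < θ := by positivity
    have hθT : 2 * θ * T = Real.pi / 2 := by rw [hθ]; field_simp; norm_num
    have hθ1 : θ ≤ 1 := by
      rw [hθ, div_le_one (by positivity)]; linarith
    have hθ2 : θ * T ≤ 1 := by linarith
    have hsin : ∀ t ∈ Icc 1 T, 1 / T ≤ Real.sin (2 * θ * t) := by
      intro t ht
      have hle : 2 * θ * t ≤ 2 * θ * T := by gcongr; exact ht.2
      have := Real.mul_le_sin (x := 2 * θ * t) (by have := ht.1; positivity) (by linarith)
      refine le_trans ?_ this
      rw [hθ]
      have : 2 / Real.pi * (2 * (Real.pi / (4 * T)) * t) = t / T := by field_simp; norm_num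
      rw [this]; gcongr; exact ht.1
    have hsin0 : ∀ t ∈ Icc 1 T, 0 < Real.sin (2 * θ * t) := fun t ht =>
      lt_of_lt_of_le (by positivity) (hsin t ht)
    have hsinv : ∀ t ∈ Icc 1 T, (Real.sin (2 * θ * t))⁻¹ ≤ T := fun t ht => by
      rw [inv_le_comm₀ (hsin0 t ht) hT0, ← one_div]; exact hsin t ht
    have main : ∀ a : ℝ, |a| = θ → ‖∫ t in (1 : ℝ)..T, u (-a) t *
        (e a t * (((Real.sin (2 * θ * t))⁻¹ : ℝ) : ℂ))‖ ≤ 2 * B + 4 * B * (1 + T) * T := by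
      intro a ha
      have := norm_integral_mul_le_of_primitive_bound (u := u (-a)) (B := B) (M := 1)
        (M' := 2 * (1 + T)) hT (hui _)
        (huB (-a) (by rw [abs_neg, ha]; exact hθ1))
        (fun t ht => hasDerivAt_cexp_div_sin a θ t (hsin0 t ht).ne') ?_ ?_ ?_
      · refine this.trans ?_
        nlinarith [mul_nonneg hB0 (by linarith : (0:ℝ) ≤ 1 + T)]
      · have h1 : ContinuousOn (fun t : ℝ => (Real.sin (2 * θ * t))⁻¹) (Icc 1 T) :=
          ContinuousOn.inv₀ (by fun_prop) fun t ht => (hsin0 t ht).ne'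
        have h2 : ContinuousOn (fun t : ℝ => -(Real.cos (2 * θ * t) * (2 * θ)) /
            (Real.sin (2 * θ * t)) ^ 2) (Icc 1 T) :=
          ContinuousOn.div (by fun_prop) (by fun_prop) fun t ht => pow_ne_zero 2 (hsin0 t ht).ne'
        have h1' := Complex.continuous_ofReal.comp_continuousOn h1
        have h2' := Complex.continuous_ofReal.comp_continuousOn h2
        exact (((hec a).continuousOn.mul continuousOn_const).mul h1').add
          ((hec a).continuousOn.mul h2')
      · rw [norm_mul, Complex.norm_exp_ofReal_mul_I, hθT]; simp
      · intro t ht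
        refine (norm_add_le _ _).trans ?_
        simp only [norm_mul, Complex.norm_exp_ofReal_mul_I, Complex.norm_real, Complex.norm_I,
          Real.norm_eq_abs, ha, one_mul, mul_one]
        rw [abs_of_pos (inv_pos.2 (hsin0 t ht))]
        have h1 : θ * (Real.sin (2 * θ * t))⁻¹ ≤ θ * T := by gcongr; exact hsinv t ht
        have h2 : |-(Real.cos (2 * θ * t) * (2 * θ)) / Real.sin (2 * θ * t) ^ 2| ≤
            2 * θ * T ^ 2 := by
          rw [abs_div, abs_neg, abs_mul, abs_of_pos (by positivity : 0 < 2 * θ), abs_pow,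
            abs_of_pos (hsin0 t ht), div_eq_mul_inv, ← inv_pow]
          have := Real.abs_cos_le_one (2 * θ * t)
          have h3 : 0 < (Real.sin (2 * θ * t))⁻¹ := inv_pos.2 (hsin0 t ht)
          calc _ ≤ 1 * (2 * θ) * T ^ 2 := by
                gcongr
                exact hsinv t ht
            _ = _ := by ring
        nlinarith
    -- Eliminating h(-t) from the two folded combinations leaves h(t)(e^{2iθt} - e^{-2iθt}) = 2i
    -- sin(2θt) h(t).
    have key : ∀ t ∈ Icc 1 T, h t = (2 * Complex.I)⁻¹ *
        (u (-θ) t * (e θ t * (((Real.sin (2 * θ * t))⁻¹ : ℝ) : ℂ)) -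
         u (- -θ) t * (e (-θ) t * (((Real.sin (2 * θ * t))⁻¹ : ℝ) : ℂ))) := by
      intro t ht
      have hs : (Real.sin (2 * θ * t) : ℂ) ≠ 0 := by exact_mod_cast (hsin0 t ht).ne'
      have hs2 : e θ t * e θ t - e (-θ) t * e (-θ) t = 2 * Complex.I * Real.sin (2 * θ * t) := by
        simp only [he]
        rw [← Complex.exp_add, ← Complex.exp_add, Complex.ofReal_sin, Complex.sin]
        push_cast
        have h1 : (θ * t * Complex.I + θ * t * Complex.I : ℂ) = 2 * θ * t * Complex.I := by ring
        have h2 : (-θ * t * Complex.I + -θ * t * Complex.I : ℂ) = -(2 * θ * t) * Complex.I := by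
          ring
        rw [h1, h2]
        linear_combination (-(Complex.exp (-(2 * θ * t) * Complex.I) -
          Complex.exp (2 * θ * t * Complex.I))) * Complex.I_sq
      have : h t * (2 * Complex.I * Real.sin (2 * θ * t)) =
          u (-θ) t * e θ t - u (- -θ) t * e (-θ) t := by
        rw [← hs2]; simp only [hu, neg_neg]; ring
      rw [Complex.ofReal_inv]
      generalize (Real.sin (2 * θ * t) : ℂ) = S at hs this ⊢
      generalize u (-θ) t = u₁ at this ⊢
      generalize u (- -θ) t = u₂ at this ⊢
      field_simp
      linear_combination this
    have hcong : ∫ x in (1 : ℝ)..T, h x = ∫ t in (1 : ℝ)..T, (2 * Complex.I)⁻¹ *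
        (u (-θ) t * (e θ t * (((Real.sin (2 * θ * t))⁻¹ : ℝ) : ℂ)) -
         u (- -θ) t * (e (-θ) t * (((Real.sin (2 * θ * t))⁻¹ : ℝ) : ℂ))) := by
      refine intervalIntegral.integral_congr fun t ht => ?_
      rw [uIcc_of_le hT] at ht
      exact key t ht
    have hint : ∀ a, IntervalIntegrable (fun t => u (-a) t *
        (e a t * (((Real.sin (2 * θ * t))⁻¹ : ℝ) : ℂ))) volume 1 T := by
      intro a
      refine (hui _ _ _).mul_continuousOn ((hec a).continuousOn.mul
        (Complex.continuous_ofReal.comp_continuousOn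
          (ContinuousOn.inv₀ (by fun_prop) fun t ht => ?_)))
      rw [uIcc_of_le hT] at ht
      exact (hsin0 t ht).ne'
    rw [hcong, intervalIntegral.integral_const_mul, intervalIntegral.integral_sub (hint θ)
      (hint (-θ)), norm_mul]
    have h1 := main θ (abs_of_pos hθ0)
    have h2 := main (-θ) (by rw [abs_neg, abs_of_pos hθ0])
    have h3 := (norm_sub_le _ _).trans (add_le_add h1 h2)
    have h4 : ‖(2 * Complex.I)⁻¹‖ = 1 / 2 := by simp
    rw [h4]
    linarith
  refine ⟨(∫ x in (0 : ℝ)..1, ‖h x‖) + 10 * B, fun t ht => ?_⟩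
  have hN : 0 ≤ ∫ x in (0 : ℝ)..1, ‖h x‖ :=
    intervalIntegral.integral_nonneg zero_le_one fun _ _ => norm_nonneg _
  rcases le_total t 1 with h1 | h1
  · have := hsmall t ht h1
    nlinarith [sq_nonneg t, mul_nonneg hN (sq_nonneg t), mul_nonneg hB0 (sq_nonneg t)]
  · rw [← intervalIntegral.integral_add_adjacent_intervals (hii 0 1) (hii 1 t)]
    have h2 := norm_add_le (∫ x in (0 : ℝ)..1, h x) (∫ x in (1 : ℝ)..t, h x)
    have h3 := hbig t h1
    have h4 := hsmall 1 zero_le_one le_rfl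
    nlinarith [mul_nonneg hN (sq_nonneg t), mul_nonneg hB0 (sq_nonneg t),
      mul_nonneg hB0 (sq_nonneg (t - 1))]

theorem intervalIntegral_symm_eq {E : ℝ → ℂ} (hE : ∀ a b, IntervalIntegrable E volume a b) (r : ℝ) :
    ∫ y in (-r)..r, E y = ∫ y in (0 : ℝ)..r, (E y + E (-y)) := by
  have hn : IntervalIntegrable (fun t => E (-t)) volume 0 r := by
    simpa using (hE 0 (-r)).comp_sub_left 0
  rw [intervalIntegral.integral_add (hE _ _) hn,
    intervalIntegral.integral_comp_neg, neg_zero, add_comm,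
    intervalIntegral.integral_add_adjacent_intervals (hE _ _) (hE _ _)]

theorem intervalIntegrable_of_locallyIntegrable {h : ℝ → ℂ} (hh : LocallyIntegrable h) (a b : ℝ) :
    IntervalIntegrable h volume a b :=
  (hh.integrableOn_isCompact isCompact_uIcc).intervalIntegrable

theorem locallyIntegrable_comp_neg {h : ℝ → ℂ} (hh : LocallyIntegrable h) :
    LocallyIntegrable fun t => h (-t) := by
  have := (locallyIntegrable_map_homeomorph (Homeomorph.neg ℝ) (f := h) (μ := volume)).1
  apply this
  rw [show (⇑(Homeomorph.neg ℝ) : ℝ → ℝ) = Neg.neg from rfl, Measure.map_neg_eq_self]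
  exact hh

/-- Two-sided version of `tendsto_integral_mul_of_primitive_bound`. -/
theorem tendsto_symm_integral_mul {h K K' : ℝ → ℂ} {C D : ℝ}
    (hh : LocallyIntegrable h) (hK : ∀ t, HasDerivAt K (K' t) t) (hK' : Continuous K')
    (hb : ∀ t, 0 ≤ t → ‖∫ u in (0 : ℝ)..t, h u‖ ≤ C * (1 + t ^ 2))
    (hb' : ∀ t, 0 ≤ t → ‖∫ u in (0 : ℝ)..t, h (-u)‖ ≤ C * (1 + t ^ 2))
    (hd : ∀ t, ‖K t‖ ≤ D * ((1 + t ^ 2) ^ 2)⁻¹) (hd' : ∀ t, ‖K' t‖ ≤ D * ((1 + t ^ 2) ^ 2)⁻¹) :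
    Tendsto (fun T => ∫ t in (-T)..T, h t * K t) atTop
      (𝓝 (-(∫ t in Ioi (0 : ℝ), (∫ u in (0 : ℝ)..t, h u) * K' t) +
        -∫ t in Ioi (0 : ℝ), (∫ u in (0 : ℝ)..t, h (-u)) * -K' (-t))) := by
  have h1 := tendsto_integral_mul_of_primitive_bound hh hK hK' hb hd hd'
  have h2 := tendsto_integral_mul_of_primitive_bound (h := fun t => h (-t))
    (K := fun t => K (-t)) (K' := fun t => -K' (-t)) (C := C) (D := D) (locallyIntegrable_comp_neg hh)
    (fun t => by simpa [Function.comp_def] using (hK (-t)).scomp t (hasDerivAt_neg t))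
    (by fun_prop) hb' (fun t => by simpa using hd (-t)) (fun t => by simpa using hd' (-t))
  have hKc : Continuous K := continuous_iff_continuousAt.2 fun t => (hK t).continuousAt
  refine (h1.add h2).congr fun T => ?_
  have hi : ∀ a b, IntervalIntegrable (fun t => h t * K t) volume a b := fun a b =>
    (intervalIntegrable_of_locallyIntegrable hh a b).mul_continuousOn hKc.continuousOn
  have hn : IntervalIntegrable (fun t => h (-t) * K (-t)) volume 0 T :=
    (intervalIntegrable_of_locallyIntegrable (locallyIntegrable_comp_neg hh) 0 T).mul_continuousOn (by fun_prop)
  rw [intervalIntegral_symm_eq hi, intervalIntegral.integral_add (hi _ _) hn]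

/-! ### Abel summation and mollifiers -/

/-- Smooth (Abel-type) summation of a convergent symmetric improper integral. -/
theorem tendsto_integral_mul_cutoff {E χ χ' : ℝ → ℂ} {L : ℂ} {R : ℝ} (hR : 0 < R)
    (hE : LocallyIntegrable E) (hL : Tendsto (fun r => ∫ y in (-r)..r, E y) atTop (𝓝 L))
    (hχ : ∀ t, HasDerivAt χ (χ' t) t) (hχ' : Continuous χ') (hev : ∀ t, χ (-t) = χ t)
    (h0 : χ 0 = 1) (hsupp : ∀ t, R ≤ |t| → χ t = 0) :
    Tendsto (fun ε : ℝ => ∫ y, χ (ε * y) * E y) (𝓝[>] 0) (𝓝 L) := by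
  have hEi := intervalIntegrable_of_locallyIntegrable hE
  have hEn := intervalIntegrable_of_locallyIntegrable (locallyIntegrable_comp_neg hE)
  have hei : ∀ a b, IntervalIntegrable (fun y => E y + E (-y)) volume a b := fun a b =>
    (hEi a b).add (hEn a b)
  have hχc : Continuous χ := continuous_iff_continuousAt.2 fun t => (hχ t).continuousAt
  set I : ℝ → ℂ := fun r => ∫ y in (0 : ℝ)..r, (E y + E (-y)) with hI
  have hIc : Continuous I := intervalIntegral.continuous_primitive hei 0
  have hIL : Tendsto I atTop (𝓝 L) := hL.congr fun r => intervalIntegral_symm_eq hEi r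
  obtain ⟨B, hB⟩ : ∃ B, ∀ r, 0 ≤ r → ‖I r‖ ≤ B := by
    obtain ⟨r₀, hr₀⟩ := (hIL.norm.eventually (gt_mem_nhds (lt_add_one ‖L‖))).exists_forall_of_atTop
    obtain ⟨B, hB⟩ := (isCompact_Icc (a := (0 : ℝ)) (b := r₀)).exists_bound_of_continuousOn
      hIc.continuousOn
    refine ⟨max B (‖L‖ + 1), fun r hr => ?_⟩
    rcases le_total r r₀ with h | h
    · exact (hB r ⟨hr, h⟩).trans (le_max_left _ _)
    · exact (hr₀ r h).le.trans (le_max_right _ _)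
  have hrep : ∀ ε : ℝ, 0 < ε → ∫ y, χ (ε * y) * E y = -∫ u in (0 : ℝ)..R, I (u / ε) * χ' u := by
    intro ε hε
    have hRε : 0 ≤ R / ε := by positivity
    have hz : ∀ y, y ∉ Ioc (-(R / ε)) (R / ε) → χ (ε * y) * E y = 0 := by
      intro y hy
      rw [hsupp, zero_mul]
      rw [abs_mul, abs_of_pos hε, ← div_le_iff₀' hε]
      by_contra hlt
      rw [not_le, abs_lt] at hlt
      exact hy ⟨hlt.1, hlt.2.le⟩
    rw [← setIntegral_eq_integral_of_forall_compl_eq_zero hz,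
      ← intervalIntegral.integral_of_le (by linarith), intervalIntegral_symm_eq]
    · have e1 : ∀ y, χ (ε * y) * E y + χ (ε * -y) * E (-y) = (E y + E (-y)) * χ (ε * y) := by
        intro y; rw [mul_neg, hev]; ring
      simp_rw [e1]
      have hd : ∀ t, HasDerivAt (fun y => χ (ε * y)) (χ' (ε * t) * ε) t := fun t => by
        have := (hχ (ε * t)).scomp t ((hasDerivAt_id t).const_mul ε)
        simpa [mul_comm, Function.comp_def] using this
      rw [integral_mul_eq_of_hasDerivAt hRε (hei _ _) (fun t _ => hd t)
        (by fun_prop : Continuous fun t => χ' (ε * t) * ε).continuousOn]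
      have e2 : χ (ε * (R / ε)) = 0 := by
        apply hsupp; rw [mul_div_cancel₀ _ hε.ne']; exact le_abs_self _
      rw [e2, mul_zero, zero_sub]
      congr 1
      have := intervalIntegral.smul_integral_comp_mul_left (a := 0) (b := R / ε)
        (fun u => I (u / ε) * χ' u) ε
      rw [mul_zero, mul_div_cancel₀ _ hε.ne'] at this
      rw [← this, ← intervalIntegral.integral_smul]
      refine intervalIntegral.integral_congr fun t _ => ?_
      simp only [Complex.real_smul, mul_div_cancel_left₀ _ hε.ne', hI]
      ring
    · intro a b
      exact (hEi a b).continuousOn_mul (by fun_prop)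
  have hlim : Tendsto (fun ε : ℝ => -∫ u in (0 : ℝ)..R, I (u / ε) * χ' u) (𝓝[>] 0)
      (𝓝 (-∫ u in (0 : ℝ)..R, L * χ' u)) := by
    refine Tendsto.neg (intervalIntegral.tendsto_integral_filter_of_dominated_convergence
      (fun u => B * ‖χ' u‖) ?_ ?_ ?_ ?_)
    · exact Eventually.of_forall fun ε => (by fun_prop :
        Continuous fun u => I (u / ε) * χ' u).aestronglyMeasurable
    · filter_upwards [self_mem_nhdsWithin] with ε hε
      refine Eventually.of_forall fun u hu => ?_
      rw [uIoc_of_le hR.le] at hu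
      rw [norm_mul]
      gcongr
      exact hB _ (div_nonneg hu.1.le (le_of_lt hε))
    · exact (by fun_prop : Continuous fun u => B * ‖χ' u‖).intervalIntegrable _ _
    · refine Eventually.of_forall fun u hu => ?_
      rw [uIoc_of_le hR.le] at hu
      refine Tendsto.mul_const _ (hIL.comp (f := fun ε : ℝ => u / ε) ?_)
      simp only [div_eq_mul_inv]
      exact Tendsto.const_mul_atTop hu.1 tendsto_inv_nhdsGT_zero
  have hval : -∫ u in (0 : ℝ)..R, L * χ' u = L := by
    rw [intervalIntegral.integral_const_mul, intervalIntegral.integral_eq_sub_of_hasDerivAt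
      (fun t _ => hχ t) (hχ'.intervalIntegrable _ _), h0, hsupp R (le_abs_self R)]
    ring
  rw [hval] at hlim
  refine hlim.congr' ?_
  filter_upwards [self_mem_nhdsWithin] with ε hε
  exact (hrep ε hε).symm

/-- The average of the dilated translates of `K` with weight `ρ`. -/
noncomputable def mollify (ρ K : ℝ → ℂ) (ε t : ℝ) : ℂ := ∫ v, ρ v * K (t - ε * v)

/-- A form of Peetre's inequality: translating the weight by εv costs only a polynomial factor in v,
uniformly for |ε| ≤ 1. -/
theorem one_add_sq_inv_le {ε : ℝ} (hε : |ε| ≤ 1) (t v : ℝ) :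
    ((1 + (t - ε * v) ^ 2) ^ 2)⁻¹ ≤ 4 * (1 + v ^ 2) ^ 2 * ((1 + t ^ 2) ^ 2)⁻¹ := by
  have h1 : (ε * v) ^ 2 ≤ v ^ 2 := by
    rw [mul_pow]
    have : ε ^ 2 ≤ 1 := by rw [← sq_abs]; exact pow_le_one₀ (abs_nonneg _) hε
    nlinarith [sq_nonneg v]
  have h2 : 1 + t ^ 2 ≤ 2 * (1 + v ^ 2) * (1 + (t - ε * v) ^ 2) := by
    nlinarith [sq_nonneg (t - 2 * (ε * v)), mul_nonneg (sq_nonneg v) (sq_nonneg (t - ε * v))]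
  have h3 : (1 + t ^ 2) ^ 2 ≤ (2 * (1 + v ^ 2) * (1 + (t - ε * v) ^ 2)) ^ 2 := by gcongr
  rw [← div_eq_mul_inv, le_div_iff₀ (by positivity), inv_mul_le_iff₀ (by positivity)]
  linarith

section
variable {ρ K : ℝ → ℂ} {D : ℝ}

theorem integrable_mollify_integrand (hρ : Integrable ρ) (hK : Continuous K)
    (hd : ∀ t, ‖K t‖ ≤ D * ((1 + t ^ 2) ^ 2)⁻¹) (ε t : ℝ) :
    Integrable fun v => ρ v * K (t - ε * v) := by
  refine hρ.mul_bdd (c := D) (by fun_prop) (Eventually.of_forall fun v => ?_)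
  have hD : 0 ≤ D := by simpa using (norm_nonneg _).trans (hd 0)
  refine (hd _).trans (mul_le_of_le_one_right hD ?_)
  exact inv_le_one_of_one_le₀ (one_le_pow₀ (by nlinarith [sq_nonneg (t - ε * v)]))

/-- Peetre's inequality under the integral sign. The bound does not depend on ε, so it serves as a
dominating function when ε → 0. -/
theorem norm_mollify_le (hw : Integrable fun v => (1 + v ^ 2) ^ 2 * ‖ρ v‖)
    (hd : ∀ t, ‖K t‖ ≤ D * ((1 + t ^ 2) ^ 2)⁻¹) {ε : ℝ} (hε : |ε| ≤ 1) (t : ℝ) :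
    ‖mollify ρ K ε t‖ ≤
      4 * D * (∫ v, (1 + v ^ 2) ^ 2 * ‖ρ v‖) * ((1 + t ^ 2) ^ 2)⁻¹ := by
  have hD : 0 ≤ D := by simpa using (norm_nonneg _).trans (hd 0)
  have e : 4 * D * (∫ v, (1 + v ^ 2) ^ 2 * ‖ρ v‖) * ((1 + t ^ 2) ^ 2)⁻¹ =
      ∫ v, 4 * D * ((1 + t ^ 2) ^ 2)⁻¹ * ((1 + v ^ 2) ^ 2 * ‖ρ v‖) := by
    rw [integral_const_mul]; ring
  rw [e]
  refine norm_integral_le_of_norm_le (hw.const_mul _) (Eventually.of_forall fun v => ?_)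
  rw [norm_mul]
  calc ‖ρ v‖ * ‖K (t - ε * v)‖
      ≤ ‖ρ v‖ * (D * (4 * (1 + v ^ 2) ^ 2 * ((1 + t ^ 2) ^ 2)⁻¹)) := by
        gcongr
        refine (hd _).trans ?_
        gcongr
        exact one_add_sq_inv_le hε t v
    _ = _ := by ring

theorem norm_le_const_of_decay (hd : ∀ t, ‖K t‖ ≤ D * ((1 + t ^ 2) ^ 2)⁻¹) (t : ℝ) : ‖K t‖ ≤ D := by
  have hD : 0 ≤ D := by simpa using (norm_nonneg _).trans (hd 0)
  refine (hd _).trans (mul_le_of_le_one_right hD ?_)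
  exact inv_le_one_of_one_le₀ (one_le_pow₀ (by nlinarith [sq_nonneg t]))

theorem continuous_mollify (hρ : Integrable ρ) (hK : Continuous K)
    (hd : ∀ t, ‖K t‖ ≤ D * ((1 + t ^ 2) ^ 2)⁻¹) (ε : ℝ) : Continuous (mollify ρ K ε) := by
  refine continuous_of_dominated (bound := fun v => ‖ρ v‖ * D)
    (fun t => (integrable_mollify_integrand hρ hK hd ε t).aestronglyMeasurable) (fun t => ?_)
    (hρ.norm.mul_const D) (Eventually.of_forall fun v => by fun_prop)
  refine Eventually.of_forall fun v => ?_
  rw [norm_mul]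
  gcongr
  exact norm_le_const_of_decay hd _

theorem tendsto_mollify (hρ : Integrable ρ) (h1 : ∫ v, ρ v = 1) (hK : Continuous K)
    (hd : ∀ t, ‖K t‖ ≤ D * ((1 + t ^ 2) ^ 2)⁻¹) (t : ℝ) :
    Tendsto (fun ε => mollify ρ K ε t) (𝓝[>] 0) (𝓝 (K t)) := by
  have : K t = ∫ v, ρ v * K t := by rw [integral_mul_const, h1, one_mul]
  rw [this]
  refine tendsto_integral_filter_of_dominated_convergence (fun v => ‖ρ v‖ * D)
    (Eventually.of_forall fun ε => (integrable_mollify_integrand hρ hK hd ε t).aestronglyMeasurable)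
    (Eventually.of_forall fun ε => Eventually.of_forall fun v => ?_) (hρ.norm.mul_const D)
    (Eventually.of_forall fun v => ?_)
  · rw [norm_mul]
    gcongr
    exact norm_le_const_of_decay hd _
  · have hc : Continuous fun ε : ℝ => ρ v * K (t - ε * v) := by fun_prop
    have := (hc.tendsto 0).mono_left (nhdsWithin_le_nhds (s := Ioi 0))
    simpa using this

theorem hasDerivAt_mollify {K' : ℝ → ℂ} (hρ : Integrable ρ) (hK : ∀ t, HasDerivAt K (K' t) t)
    (hK' : Continuous K') (hd : ∀ t, ‖K t‖ ≤ D * ((1 + t ^ 2) ^ 2)⁻¹)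
    (hd' : ∀ t, ‖K' t‖ ≤ D * ((1 + t ^ 2) ^ 2)⁻¹) (ε t : ℝ) :
    HasDerivAt (mollify ρ K ε) (mollify ρ K' ε t) t := by
  have hKc : Continuous K := continuous_iff_continuousAt.2 fun t => (hK t).continuousAt
  refine (hasDerivAt_integral_of_dominated_loc_of_deriv_le (s := univ)
    (F := fun t v => ρ v * K (t - ε * v)) (F' := fun t v => ρ v * K' (t - ε * v))
    (bound := fun v => ‖ρ v‖ * D) univ_mem
    (Eventually.of_forall fun x => (integrable_mollify_integrand hρ hKc hd ε x).aestronglyMeasurable)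
    (integrable_mollify_integrand hρ hKc hd ε t)
    (integrable_mollify_integrand hρ hK' hd' ε t).aestronglyMeasurable
    (Eventually.of_forall fun v x _ => ?_) (hρ.norm.mul_const D)
    (Eventually.of_forall fun v x _ => ?_)).2
  · rw [norm_mul]
    gcongr
    exact norm_le_const_of_decay hd' _
  · exact ((hK _).comp_sub_const x (ε * v)).const_mul _

theorem integrable_of_decay (hK : Continuous K) (hd : ∀ t, ‖K t‖ ≤ D * ((1 + t ^ 2) ^ 2)⁻¹) :
    Integrable K := by
  have hD : 0 ≤ D := by simpa using (norm_nonneg _).trans (hd 0)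
  refine (integrable_inv_one_add_sq.const_mul D).mono' hK.aestronglyMeasurable
    (Eventually.of_forall fun t => (hd t).trans ?_)
  gcongr
  nlinarith [sq_nonneg t, sq_nonneg (t ^ 2)]

end

/-! ### Parseval identity under conditional convergence -/

/-- The oscillating factor `exp (2πi t z)`. -/
noncomputable def osc (t z : ℝ) : ℂ := Complex.exp ((2 * Real.pi * t * z : ℝ) * Complex.I)

theorem norm_osc (t z : ℝ) : ‖osc t z‖ = 1 := Complex.norm_exp_ofReal_mul_I _

@[fun_prop]
theorem continuous_osc {X : Type*} [TopologicalSpace X] {a b : X → ℝ} (ha : Continuous a)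
    (hb : Continuous b) : Continuous fun x => osc (a x) (b x) := by
  unfold osc; fun_prop

theorem osc_mul (s t z : ℝ) : osc s z * osc t z = osc (s + t) z := by
  unfold osc; rw [← Complex.exp_add]; push_cast; ring_nf

/-- The Fourier transform of `χ (ε ·)` times the inverse transform of `K` is a mollification
of `K`. -/
theorem integral_cutoff_mul_osc {χ ρ K : ℝ → ℂ} (hχ : Integrable χ) (hχc : Continuous χ)
    (hK : Integrable K) (hKc : Continuous K)
    (hρ : ∀ v, ρ v = ∫ u, χ u * osc (-v) u) {ε : ℝ} (hε : 0 < ε) (t : ℝ) :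
    ∫ z, χ (ε * z) * (∫ τ, K τ * osc τ z) * osc (-t) z = mollify ρ K ε t := by
  have hχε : Integrable fun z => χ (ε * z) := hχ.comp_mul_left' hε.ne'
  -- The cutoff makes the double integral absolutely convergent. Integrating in z first gives the
  -- dilated kernel ε⁻¹ρ((t - τ)/ε) against K.
  have hint : Integrable (fun p : ℝ × ℝ => χ (ε * p.1) * K p.2 * osc (p.2 - t) p.1)
      (volume.prod volume) := by
    refine (hχε.mul_prod hK).mul_bdd (c := 1) (by fun_prop)
      (Eventually.of_forall fun p => (norm_osc _ _).le)
  have hsw := integral_integral_swap (f := fun z τ => χ (ε * z) * K τ * osc (τ - t) z) hint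
  have e1 : ∀ z, χ (ε * z) * (∫ τ, K τ * osc τ z) * osc (-t) z =
      ∫ τ, χ (ε * z) * K τ * osc (τ - t) z := by
    intro z
    rw [← integral_const_mul, ← integral_mul_const]
    refine integral_congr_ae (Eventually.of_forall fun τ => ?_)
    simp only
    rw [sub_eq_add_neg, ← osc_mul]; ring
  have e2 : ∀ τ, ∫ z, χ (ε * z) * K τ * osc (τ - t) z = K τ * ((ε : ℂ)⁻¹ * ρ ((t - τ) / ε)) := by
    intro τ
    have h := Measure.integral_comp_mul_left (fun u => χ u * osc (-((t - τ) / ε)) u) ε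
    rw [← hρ, abs_of_pos (inv_pos.2 hε), Complex.real_smul, Complex.ofReal_inv] at h
    rw [← h, ← integral_const_mul]
    refine integral_congr_ae (Eventually.of_forall fun z => ?_)
    have : osc (-((t - τ) / ε)) (ε * z) = osc (τ - t) z := by
      unfold osc; congr 3; field_simp; ring
    simp only [this]; ring
  simp_rw [e1]
  rw [hsw]
  simp_rw [e2]
  have h3 := Measure.integral_comp_mul_left (fun w => ρ (w / ε) * K (t - w)) ε
  have h4 := integral_sub_left_eq_self (fun w => ρ (w / ε) * K (t - w)) volume t
  rw [← h4, abs_of_pos (inv_pos.2 hε), Complex.real_smul, Complex.ofReal_inv,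
    ← integral_const_mul] at h3
  unfold mollify
  simp only [sub_sub_cancel, mul_div_cancel_left₀ _ hε.ne'] at h3
  rw [h3]
  exact integral_congr_ae (Eventually.of_forall fun z => by simp only; ring)

/-- A smooth even cutoff whose Fourier transform is an absolutely integrable kernel of mass one
with good decay. -/
theorem exists_cutoff : ∃ χ χ' ρ : ℝ → ℂ, Continuous χ ∧ Integrable χ ∧
    (∀ t, HasDerivAt χ (χ' t) t) ∧ Continuous χ' ∧ (∀ t, χ (-t) = χ t) ∧ χ 0 = 1 ∧
    (∀ t, 2 ≤ |t| → χ t = 0) ∧ (∀ v, ρ v = ∫ u, χ u * osc (-v) u) ∧ Integrable ρ ∧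
    Integrable (fun v => (1 + v ^ 2) ^ 2 * ‖ρ v‖) ∧ ∫ v, ρ v = 1 := by
  let b : ContDiffBump (0 : ℝ) := ⟨1, 2, one_pos, one_lt_two⟩
  let χ : ℝ → ℂ := fun t => (b t : ℂ)
  have hsm : ContDiff ℝ (⊤ : ℕ∞) χ := Complex.ofRealCLM.contDiff.comp b.contDiff
  have hcs : HasCompactSupport χ := b.hasCompactSupport.comp_left (g := ((↑) : ℝ → ℂ)) (by simp)
  let X : SchwartzMap ℝ ℂ := hcs.toSchwartzMap hsm
  let R : SchwartzMap ℝ ℂ := FourierTransform.fourier X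
  have hR : ∀ v, R v = ∫ u, χ u * osc (-v) u := by
    intro v
    have : R v = FourierTransform.fourier (X : ℝ → ℂ) v := by rw [← SchwartzMap.fourier_coe]
    rw [this, Real.fourier_real_eq_integral_exp_smul]
    refine integral_congr_ae (Eventually.of_forall fun u => ?_)
    simp only [smul_eq_mul, osc]
    rw [mul_comm]
    congr 4
    ring
  refine ⟨χ, deriv χ, R, hsm.continuous, hsm.continuous.integrable_of_hasCompactSupport hcs,
    fun t => (hsm.differentiable (by simp) t).hasDerivAt, hsm.continuous_deriv (by simp),
    fun t => by simp [χ, b.neg], ?_, ?_, hR, R.integrable, ?_, ?_⟩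
  · have : b 0 = 1 := b.one_of_mem_closedBall (by simp [b])
    simp [χ, this]
  · intro t ht
    have : b t = 0 := b.zero_of_le_dist (by simpa [b] using ht)
    simp [χ, this]
  · have h0 := R.integrable_pow_mul volume 0
    have h2 := R.integrable_pow_mul volume 2
    have h4 := R.integrable_pow_mul volume 4
    refine ((h0.add (h2.const_mul 2)).add h4).congr (Eventually.of_forall fun v => ?_)
    have h2' : |v| ^ 2 = v ^ 2 := sq_abs v
    have h4' : |v| ^ 4 = v ^ 4 := by rw [show 4 = 2 * 2 by norm_num, pow_mul, pow_mul, sq_abs]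
    simp only [Pi.add_apply, Real.norm_eq_abs, h2', h4']
    ring
  -- The mass of ρ is the inverse Fourier transform of ρ at 0, that is χ(0) = 1.
  · have hinv : FourierTransformInv.fourierInv R = X := FourierTransform.fourierInv_fourier_eq X
    have h0 : FourierTransformInv.fourierInv (R : ℝ → ℂ) 0 = X 0 := by
      rw [← SchwartzMap.fourierInv_coe, hinv]
    rw [Real.fourierInv_eq'] at h0
    have hX : X 0 = 1 := by
      have : b 0 = 1 := b.one_of_mem_closedBall (by simp [b])
      change χ 0 = 1
      simp [χ, this]
    rw [hX] at h0
    simpa using h0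

/-- **Parseval identity for conditionally convergent integrals.** -/
theorem conditional_parseval {h G K K' : ℝ → ℂ} {D : ℝ} (hh : LocallyIntegrable h)
    (hK : ∀ t, HasDerivAt K (K' t) t) (hK' : Continuous K')
    (hd : ∀ t, ‖K t‖ ≤ D * ((1 + t ^ 2) ^ 2)⁻¹) (hd' : ∀ t, ‖K' t‖ ≤ D * ((1 + t ^ 2) ^ 2)⁻¹)
    (hG : ∀ z, Tendsto (fun T : ℝ => ∫ t in (-T)..T, h t * osc (-t) z) atTop (𝓝 (G z)))
    (hB : ∀ Y, ∃ B, ∀ z, |z| ≤ Y → ∀ T : ℝ, 0 ≤ T → ‖∫ t in (-T)..T, h t * osc (-t) z‖ ≤ B) :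
    ∃ J, Tendsto (fun T : ℝ => ∫ t in (-T)..T, h t * K t) atTop (𝓝 J) ∧
      LocallyIntegrable (fun z => (∫ τ, K τ * osc τ z) * G z) ∧
      ∀ L, Tendsto (fun r : ℝ => ∫ z in (-r)..r, (∫ τ, K τ * osc τ z) * G z) atTop (𝓝 L) →
        L = J := by
  have hKc : Continuous K := continuous_iff_continuousAt.2 fun t => (hK t).continuousAt
  have hKi : Integrable K := integrable_of_decay hKc hd
  have hii := intervalIntegrable_of_locallyIntegrable hh
  -- Frequencies |z| ≤ 1 suffice, under θ = 2πz. Reflecting h amounts to replacing θ by -θ, so both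
  -- half-lines are covered.
  obtain ⟨C, hC, hC'⟩ : ∃ C, (∀ t, 0 ≤ t → ‖∫ u in (0 : ℝ)..t, h u‖ ≤ C * (1 + t ^ 2)) ∧
      ∀ t, 0 ≤ t → ‖∫ u in (0 : ℝ)..t, h (-u)‖ ≤ C * (1 + t ^ 2) := by
    obtain ⟨B, hB⟩ := hB 1
    have hosc : ∀ θ t : ℝ, Complex.exp ((-θ * t : ℝ) * Complex.I) = osc (-t) (θ / (2 * Real.pi)) := by
      intro θ t
      unfold osc; congr 3; field_simp
    have hθ : ∀ θ : ℝ, |θ| ≤ 1 → |θ / (2 * Real.pi)| ≤ 1 := by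
      intro θ h
      rw [abs_div, abs_of_pos (by positivity : (0 : ℝ) < 2 * Real.pi)]
      exact div_le_one_of_le₀ (h.trans (by linarith [Real.pi_gt_three])) (by positivity)
    obtain ⟨C₁, h₁⟩ := exists_primitive_bound (B := B) hh fun θ hθ1 T hT => by
      simp_rw [hosc]; exact hB _ (hθ θ hθ1) T hT
    obtain ⟨C₂, h₂⟩ := exists_primitive_bound (B := B) (locallyIntegrable_comp_neg hh)
      fun θ hθ1 T hT => by
        have := intervalIntegral.integral_comp_neg (a := -T) (b := T)
          (fun t => h t * Complex.exp ((-(-θ) * t : ℝ) * Complex.I))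
        rw [neg_neg] at this
        have e : ∀ t, h (-t) * Complex.exp ((-θ * t : ℝ) * Complex.I) =
            h (-t) * Complex.exp ((-(-θ) * -t : ℝ) * Complex.I) := fun t => by
          congr 4; ring
        simp_rw [e]
        rw [neg_neg] at *
        rw [this]
        have e2 : ∀ t : ℝ, Complex.exp ((θ * t : ℝ) * Complex.I) =
            osc (-t) (-θ / (2 * Real.pi)) := fun t => by rw [← hosc, neg_neg]
        simp_rw [e2]
        exact hB _ (hθ (-θ) (by rwa [abs_neg])) T hT
    refine ⟨max C₁ C₂, fun t ht => (h₁ t ht).trans ?_, fun t ht => (h₂ t ht).trans ?_⟩ <;> gcongr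
    · exact le_max_left _ _
    · exact le_max_right _ _
  set S : ℝ → ℝ → ℂ := fun T z => ∫ t in (-T)..T, h t * osc (-t) z with hS
  have hSc : ∀ T, Continuous (S T) := fun T =>
    intervalIntegral.continuous_of_dominated_interval (bound := fun t => ‖h t‖)
      (fun z => ((hii (-T) T).mul_continuousOn
        (by fun_prop : Continuous fun t => osc (-t) z).continuousOn).def'.aestronglyMeasurable)
      (fun z => Eventually.of_forall fun t _ => by rw [norm_mul, norm_osc, mul_one])
      (hii _ _).norm (Eventually.of_forall fun t _ => by fun_prop)
  set k : ℝ → ℂ := fun z => ∫ τ, K τ * osc τ z with hk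
  have hkc : Continuous k := by
    refine continuous_of_dominated (bound := fun t => ‖K t‖)
      (fun z => (by fun_prop : Continuous fun τ => K τ * osc τ z).aestronglyMeasurable)
      (fun z => Eventually.of_forall fun t => by rw [norm_mul, norm_osc, mul_one])
      hKi.norm (Eventually.of_forall fun t => by fun_prop)
  have hGm : AEStronglyMeasurable G :=
    aestronglyMeasurable_of_tendsto_ae (u := atTop) (f := S)
      (fun T => (hSc T).aestronglyMeasurable) (Eventually.of_forall hG)
  have hGB : ∀ Y, ∃ B, ∀ z, |z| ≤ Y → ‖G z‖ ≤ B := by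
    intro Y
    obtain ⟨B, hB⟩ := hB Y
    exact ⟨B, fun z hz => le_of_tendsto (hG z).norm
      ((eventually_ge_atTop 0).mono fun T hT => hB z hz T hT)⟩
  have hGl : LocallyIntegrable G := by
    rw [locallyIntegrable_iff]
    intro s hs
    obtain ⟨Y, hY⟩ := hs.isBounded.exists_norm_le
    obtain ⟨B, hB⟩ := hGB Y
    exact Measure.integrableOn_of_bounded hs.measure_lt_top.ne hGm
      ((ae_restrict_mem hs.measurableSet).mono fun z hz => hB z (hY z hz))
  have hkG : LocallyIntegrable fun z => k z * G z := by
    rw [← locallyIntegrableOn_univ] at hGl ⊢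
    exact hGl.continuousOn_mul hkc.continuousOn isClosed_univ.isLocallyClosed
  have hJ := tendsto_symm_integral_mul hh hK hK' hC hC' hd hd'
  refine ⟨_, hJ, hkG, fun L hL => ?_⟩
  obtain ⟨χ, χ', ρ, hχc, hχi, hχ, hχ', hev, h0, hsupp, hρ, hρi, hw, hρ1⟩ := exists_cutoff
  have hAbel := tendsto_integral_mul_cutoff two_pos hkG hL hχ hχ' hev h0 hsupp
  set W := ∫ v, (1 + v ^ 2) ^ 2 * ‖ρ v‖ with hW
  -- Both sides are limits in T of the same quantity: for finite T, Fubini equates the truncated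
  -- integral of h against the mollified kernel with the cutoff integral of k · S T.
  have hrep : ∀ ε : ℝ, 0 < ε → ε ≤ 1 → ∫ z, χ (ε * z) * (k z * G z) =
      (-(∫ t in Ioi (0 : ℝ), (∫ u in (0 : ℝ)..t, h u) * mollify ρ K' ε t) +
        -∫ t in Ioi (0 : ℝ), (∫ u in (0 : ℝ)..t, h (-u)) * -mollify ρ K' ε (-t)) := by
    intro ε hε hε1
    have hεa : |ε| ≤ 1 := by rwa [abs_of_pos hε]
    have l1 := tendsto_symm_integral_mul hh
      (fun t => hasDerivAt_mollify (D := D) hρi hK hK' hd hd' ε t)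
      (continuous_mollify hρi hK' hd' ε) hC hC' (norm_mollify_le hw hd hεa)
      (norm_mollify_le hw hd' hεa)
    have hχεi : Integrable fun z => χ (ε * z) := hχi.comp_mul_left' hε.ne'
    have e1 : ∀ T, 0 ≤ T → ∫ t in (-T)..T, h t * mollify ρ K ε t =
        ∫ z, χ (ε * z) * (k z * S T z) := by
      intro T hT
      have hneg : -T ≤ T := by linarith
      have hhi : IntegrableOn h (Ioc (-T) T) :=
        (intervalIntegrable_iff_integrableOn_Ioc_of_le hneg).1 (hii _ _)
      have hχk : Integrable fun z => χ (ε * z) * k z := by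
        refine hχεi.mul_bdd (c := ∫ τ, ‖K τ‖) hkc.aestronglyMeasurable
          (Eventually.of_forall fun z => ?_)
        refine (norm_integral_le_integral_norm _).trans (le_of_eq ?_)
        simp_rw [norm_mul, norm_osc, mul_one]
      have hint : Integrable (fun p : ℝ × ℝ => h p.1 * (χ (ε * p.2) * k p.2) * osc (-p.1) p.2)
          ((volume.restrict (Ioc (-T) T)).prod volume) :=
        (Integrable.mul_prod hhi hχk).mul_bdd (c := 1)
          (by fun_prop : Continuous fun p : ℝ × ℝ => osc (-p.1) p.2).aestronglyMeasurable
          (Eventually.of_forall fun p => (norm_osc _ _).le)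
      have hsw := integral_integral_swap
        (f := fun t z => h t * (χ (ε * z) * k z) * osc (-t) z) hint
      rw [intervalIntegral.integral_of_le hneg]
      have a1 : ∀ t, h t * mollify ρ K ε t = ∫ z, h t * (χ (ε * z) * k z) * osc (-t) z := by
        intro t
        rw [← integral_cutoff_mul_osc hχi hχc hKi hKc hρ hε, ← integral_const_mul]
        simp_rw [mul_assoc]; rfl
      have a2 : ∀ z, χ (ε * z) * (k z * S T z) =
          ∫ t in Ioc (-T) T, h t * (χ (ε * z) * k z) * osc (-t) z := by
        intro z
        rw [hS]
        simp only
        rw [intervalIntegral.integral_of_le hneg, ← mul_assoc, ← integral_const_mul]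
        refine integral_congr_ae (Eventually.of_forall fun t => ?_)
        simp only; ring
      simp_rw [a1, a2]
      exact hsw
    -- The cutoff confines z to |z| ≤ 2/ε, where the truncations are uniformly bounded; this is the
    -- domination needed for T → ∞.
    obtain ⟨B, hB⟩ := hB (2 / ε)
    have l2 : Tendsto (fun T => ∫ z, χ (ε * z) * (k z * S T z)) atTop
        (𝓝 (∫ z, χ (ε * z) * (k z * G z))) := by
      refine tendsto_integral_filter_of_dominated_convergence
        (fun z => ‖χ (ε * z)‖ * ((∫ τ, ‖K τ‖) * B))
        (Eventually.of_forall fun T => (by fun_prop :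
          Continuous fun z => χ (ε * z) * (k z * S T z)).aestronglyMeasurable) ?_
        (hχεi.norm.mul_const _)
        (Eventually.of_forall fun z => ((hG z).const_mul _).const_mul _)
      filter_upwards [eventually_ge_atTop 0] with T hT
      refine Eventually.of_forall fun z => ?_
      by_cases hz : 2 ≤ |ε * z|
      · simp [hsupp _ hz]
      · rw [norm_mul, norm_mul]
        have hzz : |z| ≤ 2 / ε := by
          rw [le_div_iff₀' hε]
          rw [abs_mul, abs_of_pos hε] at hz
          exact (not_le.1 hz).le
        have hkb : ‖k z‖ ≤ ∫ τ, ‖K τ‖ := by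
          refine (norm_integral_le_integral_norm _).trans (le_of_eq ?_)
          simp_rw [norm_mul, norm_osc, mul_one]
        gcongr
        exact hB z hzz T hT
    exact tendsto_nhds_unique l2 (l1.congr' ((eventually_ge_atTop 0).mono e1))
  -- Here s is the identity or negation, one for each half-line. Quadratic growth of p against
  -- fourth-order decay of the kernel leaves the integrable majorant 1/(1 + t²).
  have hlim : ∀ (p : ℝ → ℂ) (s : ℝ → ℝ), Continuous s → (∀ t, (s t) ^ 2 = t ^ 2) → Continuous p →
      (∀ t, 0 ≤ t → ‖p t‖ ≤ C * (1 + t ^ 2)) →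
      Tendsto (fun ε : ℝ => ∫ t in Ioi (0 : ℝ), p t * mollify ρ K' ε (s t)) (𝓝[>] 0)
        (𝓝 (∫ t in Ioi (0 : ℝ), p t * K' (s t))) := by
    intro p s hs hs2 hp hpb
    have hC0 : 0 ≤ C := by simpa using (norm_nonneg _).trans (hpb 0 le_rfl)
    refine tendsto_integral_filter_of_dominated_convergence
      (fun t => C * (4 * D * W) * (1 + t ^ 2)⁻¹)
      (Eventually.of_forall fun ε => (hp.mul
        ((continuous_mollify hρi hK' hd' ε).comp hs)).aestronglyMeasurable) ?_
      ((integrable_inv_one_add_sq.const_mul _).integrableOn)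
      (Eventually.of_forall fun t => (tendsto_mollify hρi hρ1 hK' hd' _).const_mul _)
    filter_upwards [Ioc_mem_nhdsGT (zero_lt_one' ℝ)] with ε hε
    filter_upwards [ae_restrict_mem measurableSet_Ioi] with t ht
    have hm := norm_mollify_le (K := K') hw hd' (by rw [abs_of_pos hε.1]; exact hε.2) (s t)
    rw [hs2] at hm
    rw [norm_mul]
    have h1 : (0 : ℝ) < 1 + t ^ 2 := by positivity
    calc _ ≤ (C * (1 + t ^ 2)) * (4 * D * W * ((1 + t ^ 2) ^ 2)⁻¹) := by
          gcongr
          exact hpb t (le_of_lt ht)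
      _ = _ := by field_simp
  have hp1 := hlim (fun t => ∫ u in (0 : ℝ)..t, h u) id continuous_id (fun _ => rfl)
    (intervalIntegral.continuous_primitive hii 0) hC
  have hp2 := hlim (fun t => ∫ u in (0 : ℝ)..t, h (-u)) Neg.neg continuous_neg (fun _ => neg_sq _)
    (intervalIntegral.continuous_primitive
      (intervalIntegrable_of_locallyIntegrable (locallyIntegrable_comp_neg hh)) 0) hC'
  have hneg : ∀ q : ℝ → ℂ, ∫ t in Ioi (0 : ℝ), (∫ u in (0 : ℝ)..t, h (-u)) * -q (-t) =
      -∫ t in Ioi (0 : ℝ), (∫ u in (0 : ℝ)..t, h (-u)) * q (-t) := fun q => by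
    rw [← integral_neg]; simp_rw [mul_neg]
  refine tendsto_nhds_unique hAbel ?_
  rw [hneg, neg_neg]
  refine ((hp1.neg).add hp2).congr' ?_
  filter_upwards [Ioc_mem_nhdsGT (zero_lt_one' ℝ)] with ε hε
  rw [hrep ε hε.1 hε.2, hneg, neg_neg]
  rfl

/-! ### Vertical lines and the residues of π / sin(πs) -/

/-- The point `a + i t`. -/
noncomputable def vline (a t : ℝ) : ℂ := (a : ℂ) + (t : ℂ) * Complex.I

@[simp] theorem vline_re (a t : ℝ) : (vline a t).re = a := by simp [vline]
@[simp] theorem vline_im (a t : ℝ) : (vline a t).im = t := by simp [vline]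

@[fun_prop]
theorem continuous_vline (a : ℝ) : Continuous (vline a) := by unfold vline; fun_prop

/-- The constant comes from (1 + t²)² ≤ 2 + 2t⁴ and x⁴/4! ≤ eˣ with x = η|t|. -/
theorem exp_neg_mul_abs_le {η : ℝ} (hη : 0 < η) (t : ℝ) :
    Real.exp (-η * |t|) ≤ (2 + 48 / η ^ 4) * ((1 + t ^ 2) ^ 2)⁻¹ := by
  have h1 := Real.pow_div_factorial_le_exp (x := η * |t|) (by positivity) 4
  have h2 : (η * |t|) ^ 4 = η ^ 4 * t ^ 4 := by
    rw [mul_pow, show |t| ^ 4 = (|t| ^ 2) ^ 2 by ring, sq_abs]; ring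
  rw [h2, show ((Nat.factorial 4 : ℕ) : ℝ) = 24 by norm_num [Nat.factorial]] at h1
  have h3 : 1 ≤ Real.exp (η * |t|) := Real.one_le_exp (by positivity)
  rw [neg_mul, Real.exp_neg, ← div_eq_mul_inv, le_div_iff₀ (by positivity),
    inv_mul_le_iff₀ (Real.exp_pos _)]
  have h4 : t ^ 4 ≤ 24 / η ^ 4 * Real.exp (η * |t|) := by
    rw [div_mul_eq_mul_div, le_div_iff₀ (by positivity)]
    linarith
  have h5 : 48 / η ^ 4 = 2 * (24 / η ^ 4) := by ring
  rw [h5]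
  nlinarith [sq_nonneg (t ^ 2 - 1)]

theorem integrable_exp_neg_mul_abs {η : ℝ} (hη : 0 < η) :
    Integrable fun t : ℝ => Real.exp (-η * |t|) := by
  have := integrable_of_decay (K := fun t => (Real.exp (-η * |t|) : ℂ)) (D := 2 + 48 / η ^ 4)
    (by fun_prop) fun t => by
      rw [Complex.norm_real, Real.norm_of_nonneg (Real.exp_pos _).le]
      exact exp_neg_mul_abs_le hη t
  refine this.norm.congr (Eventually.of_forall fun t => ?_)
  simp only [Complex.norm_real, Real.norm_of_nonneg (Real.exp_pos _).le]

theorem tendsto_exp_neg_mul_atTop {η : ℝ} (hη : 0 < η) :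
    Tendsto (fun T : ℝ => Real.exp (-η * T)) atTop (𝓝 0) := by
  refine Real.tendsto_exp_atBot.comp ?_
  exact tendsto_id.const_mul_atTop_of_neg (neg_neg_of_pos hη)

/-- A function holomorphic near a closed vertical strip and decaying exponentially in it is
integrable on the vertical lines of the strip. -/
theorem integrable_vline {f : ℂ → ℂ} {a C η : ℝ} (hη : 0 < η)
    (hf : ∀ s : ℂ, s.re = a → ContinuousAt f s)
    (hb : ∀ s : ℂ, s.re = a → ‖f s‖ ≤ C * Real.exp (-η * |s.im|)) :
    Integrable fun t => f (vline a t) := by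
  have hc : Continuous fun t => f (vline a t) := continuous_iff_continuousAt.2 fun t =>
    (hf _ (vline_re a t)).comp (f := vline a) (continuous_vline a).continuousAt
  exact ((integrable_exp_neg_mul_abs hη).const_mul C).mono' hc.aestronglyMeasurable
    (Eventually.of_forall fun t => by simpa using hb _ (vline_re a t))

/-- Shifting a vertical line of integration. -/
theorem integral_vline_eq {f : ℂ → ℂ} {a b C η : ℝ} (hab : a ≤ b) (hη : 0 < η)
    (hf : ∀ s : ℂ, a ≤ s.re → s.re ≤ b → DifferentiableAt ℂ f s)
    (hb : ∀ s : ℂ, a ≤ s.re → s.re ≤ b → ‖f s‖ ≤ C * Real.exp (-η * |s.im|)) :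
    ∫ t, f (vline a t) = ∫ t, f (vline b t) := by
  have hia := integrable_vline (f := f) (a := a) (C := C) hη
    (fun s h => (hf s h.ge (h.le.trans hab)).continuousAt)
    (fun s h => hb s h.ge (h.le.trans hab))
  have hib := integrable_vline (f := f) (a := b) (C := C) hη
    (fun s h => (hf s (hab.trans h.ge) h.le).continuousAt)
    (fun s h => hb s (hab.trans h.ge) h.le)
  have la := intervalIntegral_tendsto_integral hia tendsto_neg_atTop_atBot tendsto_id
  have lb := intervalIntegral_tendsto_integral hib tendsto_neg_atTop_atBot tendsto_id
  have hor : ∀ s : ℝ → ℝ, (∀ T, |s T| = |T|) → Tendsto (fun T : ℝ => ∫ x in a..b,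
      f ((x : ℂ) + (s T : ℂ) * Complex.I)) atTop (𝓝 0) := by
    intro s hs
    refine squeeze_zero_norm' (a := fun T => C * Real.exp (-η * T) * |b - a|) ?_ ?_
    · filter_upwards [eventually_ge_atTop 0] with T hT
      refine intervalIntegral.norm_integral_le_of_norm_le_const fun x hx => ?_
      rw [uIoc_of_le hab] at hx
      have := hb ((x : ℂ) + (s T : ℂ) * Complex.I) (by simpa using hx.1.le) (by simpa using hx.2)
      simpa [hs, abs_of_nonneg hT] using this
    · simpa using ((tendsto_exp_neg_mul_atTop hη).const_mul C).mul_const |b - a|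
  have hrect : ∀ T : ℝ, (∫ x in a..b, f ((x : ℂ) + ((-T : ℝ) : ℂ) * Complex.I)) -
      (∫ x in a..b, f ((x : ℂ) + (T : ℂ) * Complex.I)) +
      Complex.I • (∫ t in (-T)..T, f (vline b t)) -
      Complex.I • (∫ t in (-T)..T, f (vline a t)) = 0 := by
    intro T
    have := Complex.integral_boundary_rect_eq_zero_of_differentiableOn f (vline a (-T))
      (vline b T) (fun s hs => by
        have h1 := hs.1
        simp only [mem_preimage, vline_re, uIcc_of_le hab] at h1
        exact (hf s h1.1 h1.2).differentiableWithinAt)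
    simp only [vline_re, vline_im] at this
    exact this
  have hl := (((hor (fun T => -T) fun T => abs_neg T).sub (hor (fun T => T) fun _ => rfl)).add
    (lb.const_smul Complex.I)).sub (la.const_smul Complex.I)
  have h0 := tendsto_nhds_unique hl (tendsto_const_nhds.congr fun T => (hrect T).symm)
  have : Complex.I • ((∫ t, f (vline b t)) - ∫ t, f (vline a t)) = 0 := by
    rw [smul_sub]; simpa using h0
  have := (smul_eq_zero.1 this).resolve_left Complex.I_ne_zero
  exact (sub_eq_zero.1 this).symm

theorem sinh_abs_im_le_norm_sin (z : ℂ) : Real.sinh |z.im| ≤ ‖Complex.sin z‖ := by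
  have h := abs_norm_sub_norm_le (Complex.exp (-z * Complex.I)) (Complex.exp (z * Complex.I))
  have h2 : ‖Complex.sin z‖ =
      ‖Complex.exp (-z * Complex.I) - Complex.exp (z * Complex.I)‖ / 2 := by
    rw [Complex.sin, norm_div, norm_mul]; simp
  rw [h2, le_div_iff₀ two_pos]
  refine le_trans ?_ h
  rw [Complex.norm_exp, Complex.norm_exp]
  have e1 : (-z * Complex.I).re = z.im := by simp
  have e2 : (z * Complex.I).re = -z.im := by simp
  rw [e1, e2, ← Real.abs_sinh, Real.sinh_eq, abs_div, abs_two, div_mul_cancel₀ _ two_ne_zero]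

theorem exp_abs_le_norm_sin {z : ℂ} (hz : 1 ≤ |z.im|) :
    Real.exp |z.im| / 4 ≤ ‖Complex.sin z‖ := by
  refine le_trans ?_ (sinh_abs_im_le_norm_sin z)
  rw [Real.sinh_eq]
  have h1 : 2 ≤ Real.exp |z.im| := by linarith [Real.add_one_le_exp |z.im|]
  have h2 : Real.exp (-|z.im|) ≤ 1 := Real.exp_le_one_iff.2 (by linarith)
  linarith

/-- On a closed vertical strip, a continuous function that is `O (exp (A |Im s|) / sin (π s))` away
from the real axis decays exponentially when `A < π`. -/
theorem exists_decay_of_sin_mul_le {f : ℂ → ℂ} {a b A B : ℝ} (hA : A < Real.pi)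
    (hf : ∀ s : ℂ, a ≤ s.re → s.re ≤ b → ContinuousAt f s)
    (hb : ∀ s : ℂ, a ≤ s.re → s.re ≤ b → 1 ≤ |s.im| →
      ‖Complex.sin (Real.pi * s) * f s‖ ≤ B * Real.exp (A * |s.im|)) :
    ∃ C, ∀ s : ℂ, a ≤ s.re → s.re ≤ b → ‖f s‖ ≤ C * Real.exp (-(Real.pi - A) * |s.im|) := by
  have hcomp : IsCompact (Icc a b ×ℂ Icc (-1 : ℝ) 1) := isCompact_Icc.reProdIm isCompact_Icc
  obtain ⟨M, hM⟩ := hcomp.exists_bound_of_continuousOn (f := f) fun s hs =>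
    (hf s hs.1.1 hs.1.2).continuousWithinAt
  set η := Real.pi - A with hη
  have hη0 : 0 < η := by linarith
  refine ⟨max (M * Real.exp η) (4 * B), fun s h1 h2 => ?_⟩
  rcases le_total |s.im| 1 with h | h
  · have hm := hM s ⟨⟨h1, h2⟩, abs_le.1 h⟩
    have hM0 := (norm_nonneg _).trans hm
    calc ‖f s‖ ≤ M * 1 := by linarith
      _ ≤ M * (Real.exp η * Real.exp (-η * |s.im|)) := by
          gcongr
          rw [← Real.exp_add]
          exact Real.one_le_exp (by nlinarith)
      _ = M * Real.exp η * Real.exp (-η * |s.im|) := by ring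
      _ ≤ _ := by gcongr; exact le_max_left _ _
  · have hpi := Real.pi_gt_three
    have him : |(Real.pi * s).im| = Real.pi * |s.im| := by
      simp [abs_mul, abs_of_pos Real.pi_pos]
    have hs := exp_abs_le_norm_sin (z := Real.pi * s) (by rw [him]; nlinarith)
    rw [him] at hs
    have hB := hb s h1 h2 h
    rw [norm_mul] at hB
    have h3 : Real.exp (Real.pi * |s.im|) / 4 * ‖f s‖ ≤ B * Real.exp (A * |s.im|) :=
      (mul_le_mul_of_nonneg_right hs (norm_nonneg _)).trans hB
    have h4 : Real.exp (A * |s.im|) =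
        Real.exp (-η * |s.im|) * Real.exp (Real.pi * |s.im|) := by
      rw [← Real.exp_add, hη]; ring_nf
    have h5 : ‖f s‖ ≤ 4 * B * Real.exp (-η * |s.im|) := by
      rw [h4] at h3
      have := Real.exp_pos (Real.pi * |s.im|)
      by_contra hlt
      rw [not_le] at hlt
      nlinarith [mul_lt_mul_of_pos_left hlt this]
    refine h5.trans ?_
    gcongr
    exact le_max_right _ _

/-- The kernel `π / sin (π s)`. -/
noncomputable def piCsc (s : ℂ) : ℂ := Real.pi / Complex.sin (Real.pi * s)

theorem sin_pi_mul_ne_zero_of_ne_intCast {s : ℂ} (h : ∀ k : ℤ, s ≠ k) : Complex.sin (Real.pi * s) ≠ 0 := by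
  rw [Ne, Complex.sin_eq_zero_iff]
  rintro ⟨k, hk⟩
  refine h k (mul_left_cancel₀ (Complex.ofReal_ne_zero.2 Real.pi_ne_zero) ?_)
  rw [hk, mul_comm]

theorem sin_pi_mul_ne_zero_of_re {s : ℂ} {n : ℤ} (h1 : (n : ℝ) < s.re) (h2 : s.re < n + 1) :
    Complex.sin (Real.pi * s) ≠ 0 := by
  refine sin_pi_mul_ne_zero_of_ne_intCast fun k hk => ?_
  rw [hk, Complex.intCast_re] at h1 h2
  have h1' : n < k := by exact_mod_cast h1
  have h2' : k < n + 1 := by exact_mod_cast h2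
  omega

theorem differentiableAt_piCsc {s : ℂ} (h : Complex.sin (Real.pi * s) ≠ 0) :
    DifferentiableAt ℂ piCsc s := by
  unfold piCsc
  fun_prop (disch := exact h)

theorem piCsc_sub_natCast (s : ℂ) (n : ℕ) : piCsc (s - n) = (-1) ^ n * piCsc s := by
  unfold piCsc
  have : Complex.sin (Real.pi * (s - n)) = (-1) ^ n * Complex.sin (Real.pi * s) := by
    rw [mul_sub, mul_comm (Real.pi : ℂ) n, Complex.sin_antiperiodic.sub_nat_mul_eq]
  rw [this]
  have h : ((-1 : ℂ) ^ n)⁻¹ = (-1) ^ n := by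
    rw [← inv_pow]; norm_num
  rw [div_eq_mul_inv, mul_inv, h]; ring

theorem integrable_piCsc_mul {q : ℂ → ℂ} {a A B : ℝ} (hA : A < Real.pi) {n : ℤ}
    (h1 : (n : ℝ) < a) (h2 : a < n + 1) (hq : ∀ s : ℂ, s.re = a → ContinuousAt q s)
    (hb : ∀ s : ℂ, s.re = a → ‖q s‖ ≤ B * Real.exp (A * |s.im|)) :
    Integrable fun t => piCsc (vline a t) * q (vline a t) := by
  have hs : ∀ s : ℂ, s.re = a → Complex.sin (Real.pi * s) ≠ 0 := fun s h =>
    sin_pi_mul_ne_zero_of_re (n := n) (h ▸ h1) (h ▸ h2)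
  have hc : ∀ s : ℂ, s.re = a → ContinuousAt (fun s => piCsc s * q s) s := fun s h =>
    (differentiableAt_piCsc (hs s h)).continuousAt.mul (hq s h)
  obtain ⟨C, hC⟩ := exists_decay_of_sin_mul_le (f := fun s => piCsc s * q s) (a := a) (b := a)
    (B := Real.pi * B) hA (fun s u v => hc s (le_antisymm v u)) (fun s u v _ => by
      have := hs s (le_antisymm v u)
      have e : Complex.sin (Real.pi * s) * (piCsc s * q s) = Real.pi * q s := by
        unfold piCsc; field_simp
      rw [e, norm_mul, Complex.norm_real, Real.norm_of_nonneg Real.pi_pos.le, mul_assoc]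
      exact mul_le_mul_of_nonneg_left (hb s (le_antisymm v u)) Real.pi_pos.le)
  exact integrable_vline (f := fun s => piCsc s * q s) (sub_pos.2 hA) hc
    fun s h => hC s h.ge h.le

/-- On this line the sine turns into a hyperbolic cosine, so the line integral is elementary, with
antiderivative 2 arctan(e^{πt}). -/
theorem piCsc_vline_half (t : ℝ) : piCsc (vline (1 / 2) t) = (Real.pi / Real.cosh (Real.pi * t) : ℝ) := by
  unfold piCsc vline
  have : (Real.pi * (((1 / 2 : ℝ) : ℂ) + t * Complex.I) : ℂ) =
      (Real.pi * t : ℝ) * Complex.I + Real.pi / 2 := by push_cast; ring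
  rw [this, Complex.sin_add_pi_div_two, Complex.cos_mul_I]
  push_cast; rfl

theorem piCsc_vline_neg_half (t : ℝ) :
    piCsc (vline (-(1 / 2)) t) = -(Real.pi / Real.cosh (Real.pi * t) : ℝ) := by
  have : vline (-(1 / 2)) t = vline (1 / 2) t - (1 : ℕ) := by
    unfold vline; push_cast; ring
  rw [this, piCsc_sub_natCast, piCsc_vline_half]; simp

theorem integrable_pi_div_cosh : Integrable fun t : ℝ => Real.pi / Real.cosh (Real.pi * t) := by
  have := integrable_piCsc_mul (q := fun _ => 1) (a := 1 / 2) (A := 0) (B := 1) Real.pi_pos (n := 0)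
    (by norm_num) (by norm_num) (fun s _ => continuousAt_const) (by simp)
  simp only [piCsc_vline_half, mul_one] at this
  refine this.re.congr (Eventually.of_forall fun t => ?_)
  exact Complex.ofReal_re _

theorem integral_pi_div_cosh : ∫ t : ℝ, Real.pi / Real.cosh (Real.pi * t) = Real.pi := by
  have hd : ∀ t : ℝ, HasDerivAt (fun t => 2 * Real.arctan (Real.exp (Real.pi * t)))
      (Real.pi / Real.cosh (Real.pi * t)) t := by
    intro t
    have h1 := (((hasDerivAt_id t).const_mul Real.pi).exp.arctan).const_mul 2
    refine h1.congr_deriv ?_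
    simp only [id, mul_one]
    rw [Real.cosh_eq, Real.exp_neg]
    have := Real.exp_pos (Real.pi * t)
    field_simp
    ring
  have h1 : Tendsto (fun t => 2 * Real.arctan (Real.exp (Real.pi * t))) atTop
      (𝓝 (2 * (Real.pi / 2))) := by
    refine ((tendsto_nhds_of_tendsto_nhdsWithin Real.tendsto_arctan_atTop).comp
      (Real.tendsto_exp_atTop.comp (tendsto_id.const_mul_atTop Real.pi_pos))).const_mul 2
  have h2 : Tendsto (fun t => 2 * Real.arctan (Real.exp (Real.pi * t))) atBot
      (𝓝 (2 * Real.arctan 0)) := by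
    refine ((Real.continuous_arctan.tendsto 0).comp
      (Real.tendsto_exp_atBot.comp (tendsto_id.const_mul_atBot Real.pi_pos))).const_mul 2
  rw [integral_of_hasDerivAt_of_tendsto hd integrable_pi_div_cosh h2 h1]
  simp only [Real.arctan_zero]
  ring

theorem integral_piCsc_half : ∫ t, piCsc (vline (1 / 2) t) = Real.pi := by
  simp_rw [piCsc_vline_half]
  rw [integral_complex_ofReal, integral_pi_div_cosh]

theorem integral_piCsc_neg_half : ∫ t, piCsc (vline (-(1 / 2)) t) = -Real.pi := by
  simp_rw [piCsc_vline_neg_half]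
  rw [integral_neg, integral_complex_ofReal, integral_pi_div_cosh]

theorem integral_piCsc {a : ℝ} (h0 : 0 < a) (h1 : a ≤ 1 / 2) :
    ∫ t, piCsc (vline a t) = Real.pi := by
  have hs : ∀ s : ℂ, a ≤ s.re → s.re ≤ 1 / 2 → Complex.sin (Real.pi * s) ≠ 0 := fun s u v =>
    sin_pi_mul_ne_zero_of_re (n := 0) (by simpa using h0.trans_le u) (by norm_num; linarith)
  obtain ⟨C, hC⟩ := exists_decay_of_sin_mul_le (f := piCsc) (a := a) (b := 1 / 2) (A := 0)
    (B := Real.pi) Real.pi_pos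
    (fun s u v => (differentiableAt_piCsc (hs s u v)).continuousAt) (fun s u v _ => by
      have e : Complex.sin (Real.pi * s) * piCsc s = Real.pi := by
        have := hs s u v
        unfold piCsc; field_simp
      rw [e]; simp [abs_of_pos Real.pi_pos])
  rw [integral_vline_eq h1 (sub_pos.2 Real.pi_pos)
    (fun s u v => differentiableAt_piCsc (hs s u v)) hC, integral_piCsc_half]

/-- Crossing the pole of `π / sin (π s)` at the origin. -/
theorem integral_piCsc_mul_sub {q : ℂ → ℂ} {a A B : ℝ} (hA : A < Real.pi) (h0 : 0 < a)
    (h1 : a ≤ 1 / 2) (hq : ∀ s : ℂ, -(1 / 2) ≤ s.re → s.re ≤ a → DifferentiableAt ℂ q s)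
    (hb : ∀ s : ℂ, -(1 / 2) ≤ s.re → s.re ≤ a → ‖q s‖ ≤ B * Real.exp (A * |s.im|)) :
    (∫ t, piCsc (vline a t) * q (vline a t)) -
      ∫ t, piCsc (vline (-(1 / 2)) t) * q (vline (-(1 / 2)) t) = 2 * Real.pi * q 0 := by
  set v : ℂ → ℂ := fun w => Complex.sin (Real.pi * w) / Real.pi with hv
  have hpi : (Real.pi : ℂ) ≠ 0 := Complex.ofReal_ne_zero.2 Real.pi_ne_zero
  have hvd : Differentiable ℂ v := by rw [hv]; fun_prop
  have hv0 : v 0 = 0 := by simp [hv]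
  have hvderiv : deriv v 0 = 1 := by
    have : HasDerivAt v (Complex.cos (Real.pi * 0) * (Real.pi * 1) / Real.pi) 0 :=
      (((hasDerivAt_id (0 : ℂ)).const_mul (Real.pi : ℂ)).csin).div_const _
    rw [this.deriv]; simp [hpi]
  -- This is (q(s) - q(0)) · π/sin(πs) with the singularity at 0 removed. It has equal integrals on
  -- the two lines, so the jump is q(0) times that of π/sin(πs) alone, which is π - (-π).
  set f : ℂ → ℂ := fun w => dslope q 0 w / dslope v 0 w with hf
  have hsin : ∀ s : ℂ, -(1 / 2) ≤ s.re → s.re ≤ a → s ≠ 0 → Complex.sin (Real.pi * s) ≠ 0 := by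
    intro s u w hs
    refine sin_pi_mul_ne_zero_of_ne_intCast fun k hk => hs ?_
    rw [hk, Complex.intCast_re] at u w
    have h1 : (-1 : ℝ) < k := by linarith
    have h2 : (k : ℝ) < 1 := by linarith
    have h1' : -1 < k := by exact_mod_cast h1
    have h2' : k < 1 := by exact_mod_cast h2
    have : k = 0 := by omega
    rw [hk, this]; simp
  have hdv : ∀ s : ℂ, -(1 / 2) ≤ s.re → s.re ≤ a → dslope v 0 s ≠ 0 := by
    intro s u w h
    by_cases hs : s = 0
    · rw [hs, dslope_same, hvderiv] at h; exact one_ne_zero h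
    · have := sub_smul_dslope v 0 s
      rw [h, smul_zero, hv0, sub_zero] at this
      exact hsin s u w hs (by simpa [hv, hpi] using this.symm)
  have hfs : ∀ s : ℂ, -(1 / 2) ≤ s.re → s.re ≤ a →
      Complex.sin (Real.pi * s) * f s = Real.pi * (q s - q 0) := by
    intro s u w
    have e1 := sub_smul_dslope q 0 s
    have e2 := sub_smul_dslope v 0 s
    simp only [sub_zero, smul_eq_mul, hv0] at e1 e2
    have e3 : Complex.sin (Real.pi * s) = Real.pi * v s := by simp only [hv]; field_simp
    have := hdv s u w
    rw [e3, ← e1, ← e2]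
    simp only [hf]
    field_simp
  have hfd : ∀ s : ℂ, -(1 / 2) ≤ s.re → s.re ≤ a → DifferentiableAt ℂ f s := by
    intro s u w
    refine DifferentiableAt.div ?_ ?_ (hdv s u w)
    · by_cases hs : s = 0
      · have hopen : IsOpen (Complex.re ⁻¹' Ioo (-(1 / 2)) a) :=
          isOpen_Ioo.preimage Complex.continuous_re
        have hmem : Complex.re ⁻¹' Ioo (-(1 / 2)) a ∈ 𝓝 (0 : ℂ) :=
          hopen.mem_nhds (by simpa using h0)
        have hd : DifferentiableOn ℂ q (Complex.re ⁻¹' Ioo (-(1 / 2)) a) := fun z hz =>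
          (hq z hz.1.le hz.2.le).differentiableWithinAt
        rw [hs]
        exact ((Complex.differentiableOn_dslope hmem).2 hd).differentiableAt hmem
      · exact (differentiableAt_dslope_of_ne hs).2 (hq s u w)
    · exact ((Complex.differentiableOn_dslope univ_mem).2 hvd.differentiableOn).differentiableAt
        univ_mem
  -- If A is negative the constant q(0) does not satisfy the bound for q; a nonnegative exponent
  -- still below π covers both.
  set A' := max A 0 with hA'
  have hA'pi : A' < Real.pi := max_lt hA Real.pi_pos
  have hB0 : ‖q 0‖ ≤ B := by simpa using hb 0 (by simp) (by simpa using h0.le)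
  have hB : 0 ≤ B := (norm_nonneg _).trans hB0
  have hb' : ∀ s : ℂ, -(1 / 2) ≤ s.re → s.re ≤ a → ‖q s‖ ≤ B * Real.exp (A' * |s.im|) := by
    intro s u w
    refine (hb s u w).trans ?_
    gcongr
    exact le_max_left _ _
  obtain ⟨C, hC⟩ := exists_decay_of_sin_mul_le (f := f) (a := -(1 / 2)) (b := a) (A := A')
    (B := Real.pi * (B + B)) hA'pi (fun s u w => (hfd s u w).continuousAt) (fun s u w _ => by
      rw [hfs s u w, norm_mul, Complex.norm_real, Real.norm_of_nonneg Real.pi_pos.le, mul_assoc]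
      gcongr
      refine (norm_sub_le _ _).trans ?_
      have : 1 ≤ Real.exp (A' * |s.im|) :=
        Real.one_le_exp (mul_nonneg (le_max_right _ _) (abs_nonneg _))
      nlinarith [hb' s u w])
  have key := integral_vline_eq (a := -(1 / 2)) (b := a) (by linarith) (sub_pos.2 hA'pi) hfd hC
  have hline : ∀ (x : ℝ) (n : ℤ), -(1 / 2) ≤ x → x ≤ a → (n : ℝ) < x → x < n + 1 →
      ∫ t, f (vline x t) = (∫ t, piCsc (vline x t) * q (vline x t)) -
        (∫ t, piCsc (vline x t)) * q 0 := by
    intro x n u w hn hn'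
    have i1 := integrable_piCsc_mul (q := q) hA'pi hn hn'
      (fun s h => (hq s (h ▸ u) (h ▸ w)).continuousAt) (fun s h => hb' s (h ▸ u) (h ▸ w))
    have i2 := integrable_piCsc_mul (q := fun _ => q 0) (a := x) (A := 0) (B := B) Real.pi_pos hn hn'
      (fun s _ => continuousAt_const) (fun s _ => by simpa using hB0)
    rw [← integral_mul_const, ← integral_sub i1 i2]
    refine integral_congr_ae (Eventually.of_forall fun t => ?_)
    have hne : Complex.sin (Real.pi * vline x t) ≠ 0 :=
      sin_pi_mul_ne_zero_of_re (n := n) (by simpa using hn) (by simpa using hn')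
    have e := hfs (vline x t) (by simpa using u) (by simpa using w)
    simp only
    unfold piCsc
    field_simp
    linear_combination e
  rw [hline _ (-1) le_rfl (by linarith) (by norm_num) (by norm_num),
    hline a 0 (by linarith) le_rfl (by simpa using h0) (by norm_num; linarith),
    integral_piCsc_neg_half, integral_piCsc h0 h1] at key
  linear_combination -key

/-- Evaluation of a Mellin–Barnes integral by the residues of `π / sin (π s)` at the nonpositive
integers. -/
theorem tendsto_sum_residues {q : ℂ → ℂ} {a δ A B m : ℝ} (hA : A < Real.pi) (h0 : 0 < a)
    (h1 : a ≤ 1 / 2) (haδ : a < δ) (hm : 0 < m) (hB0 : 0 ≤ B)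
    (hq : ∀ s : ℂ, s.re < δ → DifferentiableAt ℂ q s)
    (hb : ∀ s : ℂ, s.re < δ → ‖q s‖ ≤ B * Real.exp (m * s.re) * Real.exp (A * |s.im|)) :
    Tendsto (fun N : ℕ => ∑ n ∈ Finset.range (N + 1), (-1) ^ n * q (-n)) atTop
      (𝓝 ((2 * Real.pi : ℂ)⁻¹ * ∫ t, piCsc (vline a t) * q (vline a t))) := by
  have hpi : (Real.pi : ℂ) ≠ 0 := Complex.ofReal_ne_zero.2 Real.pi_ne_zero
  have hb' : ∀ (x : ℝ) (s : ℂ), x < δ → s.re ≤ x →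
      ‖q s‖ ≤ B * Real.exp (m * x) * Real.exp (A * |s.im|) := by
    intro x s hx hs
    refine (hb s (hs.trans_lt hx)).trans ?_
    gcongr
  have hsq : ∀ n : ℕ, (((-1 : ℂ) ^ n) * (-1) ^ n) = 1 := fun n => by
    rw [← mul_pow]; norm_num
  set I : ℕ → ℂ := fun N => ∫ t, piCsc (vline (-(N + 1 / 2)) t) * q (vline (-(N + 1 / 2)) t) with hI
  have hshift : ∀ (n : ℕ) (x y : ℝ), x = y - n → ∫ t, piCsc (vline x t) * q (vline x t) =
      (-1) ^ n * ∫ t, piCsc (vline y t) * q (vline y t - n) := by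
    intro n x y hxy
    rw [← integral_const_mul]
    refine integral_congr_ae (Eventually.of_forall fun t => ?_)
    have : vline x t = vline y t - n := by rw [hxy]; unfold vline; push_cast; ring
    simp only [this, piCsc_sub_natCast]; ring
  -- Translation by n carries the crossing of -n to the crossing of 0, and antiperiodicity of the
  -- sine supplies the sign (-1)^n.
  have hstep : ∀ (n : ℕ) (x y : ℝ), 0 < y → y ≤ 1 / 2 → x = y - n → x < δ →
      (∫ t, piCsc (vline x t) * q (vline x t)) - I n = 2 * Real.pi * ((-1) ^ n * q (-n)) := by
    intro n x y hy hy' hxy hxδ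
    have key := integral_piCsc_mul_sub (q := fun s => q (s - n)) (B := B * Real.exp (m * x)) hA hy hy'
      (fun s _ hs => by
        have : DifferentiableAt ℂ q (s - n) := hq _ (by
          simp only [Complex.sub_re, Complex.natCast_re]; linarith)
        exact this.comp s (by fun_prop))
      (fun s _ hs => by
        have := hb' x (s - n) hxδ (by simp only [Complex.sub_re, Complex.natCast_re]; linarith)
        simpa using this)
    rw [zero_sub] at key
    rw [hI]
    simp only
    rw [hshift n x y hxy, hshift n (-(n + 1 / 2)) (-(1 / 2)) (by ring)]
    linear_combination (-1) ^ n * key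
  have hsum : ∀ N : ℕ, (∫ t, piCsc (vline a t) * q (vline a t)) - I N =
      2 * Real.pi * ∑ n ∈ Finset.range (N + 1), (-1) ^ n * q (-n) := by
    intro N
    induction N with
    | zero =>
      rw [hstep 0 a a h0 h1 (by simp) haδ]; simp
    | succ N ih =>
      rw [Finset.sum_range_succ, mul_add, ← ih]
      have := hstep (N + 1) (-(N + 1 / 2)) (1 / 2) (by norm_num) le_rfl (by push_cast; ring)
        (by have : (0 : ℝ) ≤ N := Nat.cast_nonneg N
            linarith)
      rw [← this]
      simp only [hI]
      ring
  -- Translated back to Re s = -1/2, the N-th remainder is at most e^{-m(N+1/2)} times a fixed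
  -- convergent integral.
  have hI0 : Tendsto I atTop (𝓝 0) := by
    have hg := (integrable_piCsc_mul (q := fun s => (Real.exp (A * |s.im|) : ℂ)) (a := -(1 / 2))
      (B := 1) hA (n := -1) (by norm_num) (by norm_num)
      (fun s _ => by fun_prop)
      (fun s _ => by rw [Complex.norm_real, Real.norm_of_nonneg (Real.exp_pos _).le, one_mul])).norm
    refine squeeze_zero_norm (a := fun N : ℕ => (B * Real.exp (-m * (N + 1 / 2))) * ∫ t,
      ‖piCsc (vline (-(1 / 2)) t) * (Real.exp (A * |(vline (-(1 / 2)) t).im|) : ℂ)‖) (fun N => ?_) ?_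
    · rw [← integral_const_mul]
      refine norm_integral_le_of_norm_le (hg.const_mul _) (Eventually.of_forall fun t => ?_)
      have hN : (0 : ℝ) ≤ N := Nat.cast_nonneg N
      have e : vline (-(N + 1 / 2)) t = vline (-(1 / 2)) t - N := by
        unfold vline; push_cast; ring
      have h3 := hb (vline (-(N + 1 / 2)) t) (by rw [vline_re]; linarith)
      rw [vline_re, vline_im] at h3
      rw [norm_mul, norm_mul, Complex.norm_real, Real.norm_of_nonneg (Real.exp_pos _).le, vline_im]
      nth_rewrite 1 [e]
      rw [piCsc_sub_natCast, norm_mul, norm_pow, norm_neg, norm_one, one_pow, one_mul]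
      calc _ ≤ ‖piCsc (vline (-(1 / 2)) t)‖ *
            (B * Real.exp (m * -(N + 1 / 2)) * Real.exp (A * |t|)) := by gcongr
        _ = _ := by rw [mul_neg, ← neg_mul]; ring
    · have h2 : Tendsto (fun N : ℕ => Real.exp (-m * ((N : ℝ) + 1 / 2))) atTop (𝓝 0) :=
        (tendsto_exp_neg_mul_atTop hm).comp
          (tendsto_atTop_add_const_right _ _ tendsto_natCast_atTop_atTop)
      simpa using (h2.const_mul B).mul_const _
  have hl := ((tendsto_const_nhds (x := ∫ t, piCsc (vline a t) * q (vline a t))).sub hI0).const_mul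
    (2 * Real.pi : ℂ)⁻¹
  rw [sub_zero] at hl
  refine hl.congr fun N => ?_
  rw [hsum, inv_mul_cancel_left₀ (by simp [hpi])]

/-! ### Ramanujan's master theorem -/

/-- The Fourier transform of an exponentially decaying function is analytic at real points. -/
theorem analyticAt_fourier_of_exp_decay {k : ℝ → ℂ} {C η : ℝ} (hη : 0 < η) (hk : Continuous k)
    (hb : ∀ t, ‖k t‖ ≤ C * Real.exp (-η * |t|)) (x : ℝ) :
    AnalyticAt ℂ (fun z : ℂ => ∫ t : ℝ, k t * Complex.exp (t * z * Complex.I)) x := by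
  have hC : 0 ≤ C := by simpa using (norm_nonneg _).trans (hb 0)
  -- Half of the decay absorbs the growth of the exponential off the real axis; the other half keeps
  -- the integrand and its derivative integrable.
  set S : Set ℂ := Complex.im ⁻¹' Ioo (-(η / 2)) (η / 2) with hS
  have hSo : IsOpen S := isOpen_Ioo.preimage Complex.continuous_im
  have hη2 : 0 < η / 2 := by linarith
  have hbound : ∀ z ∈ S, ∀ t, ‖k t * Complex.exp (t * z * Complex.I)‖ ≤
      C * Real.exp (-(η / 2) * |t|) := by
    intro z hz t
    rw [norm_mul, Complex.norm_exp]
    have hre : (t * z * Complex.I).re = -(t * z.im) := by simp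
    have h1 : -(t * z.im) ≤ η / 2 * |t| := by
      have : |z.im| ≤ η / 2 := abs_le.2 ⟨hz.1.le, hz.2.le⟩
      calc -(t * z.im) ≤ |t * z.im| := neg_le_abs _
        _ = |z.im| * |t| := by rw [abs_mul, mul_comm]
        _ ≤ _ := by gcongr
    rw [hre]
    calc _ ≤ (C * Real.exp (-η * |t|)) * Real.exp (η / 2 * |t|) := by
          gcongr
          exact hb t
      _ = _ := by rw [mul_assoc, ← Real.exp_add]; ring_nf
  have hi := (integrable_exp_neg_mul_abs hη2).const_mul C
  refine DifferentiableOn.analyticAt (s := S) (fun z hz => ?_) (hSo.mem_nhds (by simp [hS, hη]))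
  refine (hasDerivAt_integral_of_dominated_loc_of_deriv_le (s := S)
    (F := fun z (t : ℝ) => k t * Complex.exp (t * z * Complex.I))
    (F' := fun z (t : ℝ) => k t * Complex.exp (t * z * Complex.I) * (t * Complex.I))
    (bound := fun t => C * (2 + 48 / (η / 2) ^ 4) * (1 + t ^ 2)⁻¹)
    (hSo.mem_nhds hz) (Eventually.of_forall fun z => (by fun_prop : Continuous fun t : ℝ =>
      k t * Complex.exp (t * z * Complex.I)).aestronglyMeasurable)
    (hi.mono' (by fun_prop : Continuous fun t : ℝ =>
      k t * Complex.exp (t * z * Complex.I)).aestronglyMeasurable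
      (Eventually.of_forall fun t => hbound z hz t))
    (by fun_prop : Continuous fun t : ℝ =>
      k t * Complex.exp (t * z * Complex.I) * (t * Complex.I)).aestronglyMeasurable
    (Eventually.of_forall fun t w hw => ?_) (integrable_inv_one_add_sq.const_mul _)
    (Eventually.of_forall fun t w _ => ?_)).2.differentiableAt.differentiableWithinAt
  · rw [norm_mul]
    have e : ‖(t * Complex.I : ℂ)‖ = |t| := by simp
    rw [e]
    have h2 : |t| ≤ 1 + t ^ 2 := by
      rw [← sq_abs]; nlinarith [abs_nonneg t, sq_nonneg (|t| - 1)]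
    have h3 : (0 : ℝ) < 1 + t ^ 2 := by positivity
    calc _ ≤ C * ((2 + 48 / (η / 2) ^ 4) * ((1 + t ^ 2) ^ 2)⁻¹) * (1 + t ^ 2) := by
          gcongr
          exact (hbound w hw t).trans (by gcongr; exact exp_neg_mul_abs_le hη2 t)
      _ = _ := by field_simp
  · have h1 : HasDerivAt (fun z : ℂ => (t : ℂ) * z * Complex.I) (t * 1 * Complex.I) w :=
      ((hasDerivAt_id w).const_mul (t : ℂ)).mul_const _
    have := h1.cexp.const_mul (k t)
    rw [mul_one, ← mul_assoc] at this
    exact this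

/-- The integrand `Γ(s) F(-s)` of Ramanujan's master theorem. -/
noncomputable def masterKernel (F : ℂ → ℂ) (s : ℂ) : ℂ := Complex.Gamma s * F (-s)

section
variable {F : ℂ → ℂ} {δ : ℝ}

theorem differentiableAt_reflect (hF : DifferentiableOn ℂ F {u : ℂ | -δ < u.re}) {s : ℂ}
    (hs : s.re < δ) : DifferentiableAt ℂ (fun s => F (-s)) s := by
  have hopen : IsOpen {u : ℂ | -δ < u.re} := isOpen_lt continuous_const Complex.continuous_re
  have : DifferentiableAt ℂ F (-s) :=
    (hF (-s) (by simpa using hs)).differentiableAt (hopen.mem_nhds (by simpa using hs))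
  exact this.comp s (by fun_prop)

theorem differentiableAt_masterKernel (hF : DifferentiableOn ℂ F {u : ℂ | -δ < u.re}) {s : ℂ}
    (h0 : 0 < s.re) (hs : s.re < δ) : DifferentiableAt ℂ (masterKernel F) s := by
  refine DifferentiableAt.mul (Complex.differentiableAt_Gamma s fun m hm => ?_)
    (differentiableAt_reflect hF hs)
  rw [hm] at h0
  simp at h0
  linarith [(Nat.cast_nonneg m : (0 : ℝ) ≤ m)]

theorem differentiableAt_hardyQuotient (hF : DifferentiableOn ℂ F {u : ℂ | -δ < u.re}) {s : ℂ}
    (hs : s.re < δ) : DifferentiableAt ℂ (fun s => F (-s) / Complex.Gamma (-s + 1)) s := by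
  simp_rw [div_eq_mul_inv]
  refine (differentiableAt_reflect hF hs).mul ?_
  have h : DifferentiableAt ℂ (fun s : ℂ => -s + 1) s := by fun_prop
  exact DifferentiableAt.comp (g := fun s => (Complex.Gamma s)⁻¹) s
    (Complex.differentiable_one_div_Gamma (-s + 1)) h

/-- Euler's reflection formula. It exposes the quotient F(u)/Γ(u+1) at u = -s, which is what Hardy's
condition bounds, and isolates the poles in 1/sin(πs). -/
theorem sin_mul_masterKernel {s : ℂ} (hs : Complex.sin (Real.pi * s) ≠ 0) :
    Complex.sin (Real.pi * s) * masterKernel F s =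
      Real.pi * (F (-s) / Complex.Gamma (-s + 1)) := by
  have h := Complex.Gamma_mul_Gamma_one_sub s
  have hpi : (Real.pi : ℂ) ≠ 0 := Complex.ofReal_ne_zero.2 Real.pi_ne_zero
  have hne : Complex.Gamma s * Complex.Gamma (1 - s) ≠ 0 := by
    rw [h]; exact div_ne_zero hpi hs
  have h1 := right_ne_zero_of_mul hne
  rw [show -s + 1 = 1 - s by ring]
  unfold masterKernel
  rw [eq_div_iff hs] at h
  field_simp
  linear_combination F (-s) * h

theorem masterKernel_eq_piCsc_mul {s : ℂ} (hs : Complex.sin (Real.pi * s) ≠ 0) :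
    masterKernel F s = piCsc s * (F (-s) / Complex.Gamma (-s + 1)) := by
  have := sin_mul_masterKernel (F := F) hs
  unfold piCsc
  rw [div_mul_eq_mul_div, ← this, mul_div_cancel_left₀ _ hs]

theorem exists_masterKernel_decay (hF : IsHardyClass δ F) :
    ∃ η, 0 < η ∧ ∀ a b, 0 < a → b < δ → ∃ C, ∀ s : ℂ, a ≤ s.re → s.re ≤ b →
      ‖masterKernel F s‖ ≤ C * Real.exp (-η * |s.im|) := by
  obtain ⟨hd, C, P, A, hA, hC⟩ := hF
  refine ⟨Real.pi - A, sub_pos.2 hA, fun a b ha hb => ?_⟩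
  refine exists_decay_of_sin_mul_le (B := Real.pi * (|C| * Real.exp (|P| * (|a| + |b|)))) hA
    (fun s u v => (differentiableAt_masterKernel hd (ha.trans_le u)
      (v.trans_lt hb)).continuousAt) fun s u v him => ?_
  have hs : Complex.sin (Real.pi * s) ≠ 0 := by
    refine sin_pi_mul_ne_zero_of_ne_intCast fun k hk => ?_
    rw [hk] at him
    simp at him
    linarith
  have h := hC (-s) (by simpa using v.trans_lt hb)
  rw [sin_mul_masterKernel hs, norm_mul, Complex.norm_real, Real.norm_of_nonneg Real.pi_pos.le,
    mul_assoc]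
  gcongr
  refine h.trans ?_
  rw [Real.exp_add, ← mul_assoc]
  have hre : P * (-s).re ≤ |P| * (|a| + |b|) := by
    refine (le_abs_self _).trans ?_
    rw [abs_mul, Complex.neg_re, abs_neg]
    gcongr
    rw [abs_le]
    exact ⟨by linarith [neg_abs_le a, abs_nonneg b], by linarith [le_abs_self b, abs_nonneg a]⟩
  simp only [Complex.neg_im, abs_neg]
  gcongr
  exact le_abs_self C

theorem norm_cexp_neg_mul (l : ℝ) (s : ℂ) :
    ‖Complex.exp (-(l * s))‖ = Real.exp (-l * s.re) := by
  rw [Complex.norm_exp]; simp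

/-- The Mellin–Barnes integral of the master kernel is the sum of the power series. -/
theorem exists_hasSum_integral (hF : IsHardyClass δ F) {σ : ℝ} (h0 : 0 < σ)
    (hσ : σ < δ) : ∃ l₀ : ℝ, ∀ l < l₀, ∀ S : ℂ,
      HasSum (fun n : ℕ => bracketIndicator n * F n * Complex.exp (l * n)) S →
      S = (2 * Real.pi : ℂ)⁻¹ *
        ∫ t, masterKernel F (vline σ t) * Complex.exp (-(l * vline σ t)) := by
  obtain ⟨η, hη, hdec⟩ := exists_masterKernel_decay hF
  obtain ⟨hd, C, P, A, hA, hC⟩ := hF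
  -- Hardy's bound times |e^{-ls}| is of size e^{-(P+l) Re s} in the real direction, which decays to
  -- the left exactly when l < -P.
  refine ⟨-P, fun l hl S hS => ?_⟩
  -- The master kernel is regular throughout 0 < Re s < δ, but π/sin(πs) has poles at the positive
  -- integers. The line is therefore moved left of 1 before the kernel is factored.
  set a := min σ (1 / 2) with ha
  have ha0 : 0 < a := lt_min h0 (by norm_num)
  have haσ : a ≤ σ := min_le_left _ _
  obtain ⟨D, hD⟩ := hdec a σ ha0 hσ
  have hexp : ∀ s : ℂ, DifferentiableAt ℂ (fun s : ℂ => Complex.exp (-(l * s))) s := fun s => by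
    fun_prop
  have hshift := integral_vline_eq (f := fun s => masterKernel F s * Complex.exp (-(l * s)))
    (C := D * Real.exp (|l| * (|a| + |σ|))) haσ hη
    (fun s u v => (differentiableAt_masterKernel hd (ha0.trans_le u) (v.trans_lt hσ)).mul (hexp s))
    (fun s u v => by
      rw [norm_mul, norm_cexp_neg_mul]
      have hre : -l * s.re ≤ |l| * (|a| + |σ|) := by
        refine (le_abs_self _).trans ?_
        rw [abs_mul, abs_neg]
        gcongr
        rw [abs_le]
        exact ⟨by linarith [neg_abs_le a, abs_nonneg σ], by linarith [le_abs_self σ, abs_nonneg a]⟩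
      have h1 := hD s u v
      calc _ ≤ (D * Real.exp (-η * |s.im|)) * Real.exp (|l| * (|a| + |σ|)) := by
            gcongr
            exact (norm_nonneg _).trans h1
        _ = _ := by ring)
  rw [← hshift]
  set q : ℂ → ℂ := fun s => F (-s) / Complex.Gamma (-s + 1) * Complex.exp (-(l * s)) with hq
  have hC0 : 0 ≤ C := by
    have h := (norm_nonneg _).trans (hC 0 (by simpa using h0.trans hσ))
    simpa using h
  have hres := tendsto_sum_residues (q := q) (a := a) (δ := δ) (B := C) (m := -(P + l)) hA ha0
    (min_le_right _ _) (haσ.trans_lt hσ) (by linarith) hC0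
    (fun s hs => (differentiableAt_hardyQuotient hd hs).mul (hexp s))
    (fun s hs => by
      have h := hC (-s) (by simpa using hs)
      simp only [hq]
      rw [norm_mul, norm_cexp_neg_mul]
      calc _ ≤ (C * Real.exp (P * (-s).re + A * |(-s).im|)) * Real.exp (-l * s.re) := by gcongr
        _ = _ := by
          rw [mul_assoc, mul_assoc, ← Real.exp_add, ← Real.exp_add, Complex.neg_re,
            Complex.neg_im, abs_neg]
          ring_nf)
  have hterm : ∀ n : ℕ, bracketIndicator n * F n * Complex.exp (l * n) = (-1) ^ n * q (-n) := by
    intro n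
    simp only [hq, bracketIndicator, neg_neg, mul_neg]
    ring
  have hS' := hS.tendsto_sum_nat.comp (tendsto_add_atTop_nat 1)
  simp_rw [hterm] at hS'
  rw [tendsto_nhds_unique hS' hres]
  congr 1
  refine integral_congr_ae (Eventually.of_forall fun t => ?_)
  have hs : Complex.sin (Real.pi * vline a t) ≠ 0 :=
    sin_pi_mul_ne_zero_of_re (n := 0) (by simpa using ha0)
      (by have : a ≤ 1 / 2 := min_le_right _ _
          norm_num; linarith)
  simp only [hq, masterKernel_eq_piCsc_mul hs]
  ring

/-- **Ramanujan's master theorem**, in the form of an inverse Mellin transform. -/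
theorem eq_integral_masterKernel {f : ℝ → ℂ} {β : ℝ} (hβ : β ≠ 0) (hF : IsHardyClass δ F)
    (hf : HasIndicatorExpansion f F β) {σ : ℝ} (h0 : 0 < σ) (hσ : σ < δ) {x : ℝ} (hx : 0 < x) :
    f x = (2 * Real.pi : ℂ)⁻¹ *
      ∫ t, masterKernel F (vline σ t) * Complex.exp (-((β * Real.log x : ℝ) * vline σ t)) := by
  obtain ⟨l₀, hl₀⟩ := exists_hasSum_integral hF h0 hσ
  obtain ⟨η, hη, hdec⟩ := exists_masterKernel_decay hF
  obtain ⟨D, hD⟩ := hdec σ σ h0 hσ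
  obtain ⟨hfa, ρ, hρ, hser⟩ := hf
  set k : ℝ → ℂ := fun t => masterKernel F (vline σ t) with hk
  have hkc : Continuous k := continuous_iff_continuousAt.2 fun t =>
    (differentiableAt_masterKernel hF.1 (by simpa using h0) (by simpa using hσ)).continuousAt.comp
      (f := vline σ) (continuous_vline σ).continuousAt
  have hkb : ∀ t, ‖k t‖ ≤ D * Real.exp (-η * |t|) := fun t => by
    simpa using hD (vline σ t) (by simp) (by simp)
  set f₁ : ℝ → ℂ := fun x => (2 * Real.pi : ℂ)⁻¹ *
      ∫ t, masterKernel F (vline σ t) * Complex.exp (-((β * Real.log x : ℝ) * vline σ t)) with hf₁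
  have hrep : ∀ x, f₁ x = (2 * Real.pi : ℂ)⁻¹ * (Complex.exp (-((β * σ : ℝ) * (Real.log x : ℝ))) *
      (fun z : ℂ => ∫ t : ℝ, k t * Complex.exp (t * z * Complex.I)) ((-β * Real.log x : ℝ) : ℂ)) := by
    intro x
    simp only [hf₁]
    congr 1
    rw [← integral_const_mul]
    refine integral_congr_ae (Eventually.of_forall fun t => ?_)
    simp only [hk]
    rw [mul_left_comm, ← Complex.exp_add]
    congr 2
    unfold vline; push_cast; ring
  have hf₁a : AnalyticOnNhd ℝ f₁ (Ioi 0) := by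
    intro x hx
    have hl0 : AnalyticAt ℝ Real.log x := analyticAt_log hx
    have hlog : AnalyticAt ℝ (fun x : ℝ => ((Real.log x : ℝ) : ℂ)) x :=
      AnalyticAt.fun_comp (Complex.ofRealCLM.analyticAt (Real.log x)) hl0
    have hlog' : AnalyticAt ℝ (fun x : ℝ => ((-β * Real.log x : ℝ) : ℂ)) x :=
      AnalyticAt.fun_comp (Complex.ofRealCLM.analyticAt (-β * Real.log x)) (analyticAt_const.mul hl0)
    have h1 : AnalyticAt ℝ (fun x : ℝ => Complex.exp (-((β * σ : ℝ) * ((Real.log x : ℝ) : ℂ)))) x :=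
      AnalyticAt.fun_comp (analyticAt_cexp.restrictScalars (𝕜 := ℝ)) (analyticAt_const.mul hlog).neg
    have h2 := AnalyticAt.fun_comp (x := x) (f := fun x : ℝ => ((-β * Real.log x : ℝ) : ℂ))
      ((analyticAt_fourier_of_exp_decay hη hkc hkb (-β * Real.log x)).restrictScalars (𝕜 := ℝ)) hlog'
    have h3 := (analyticAt_const (v := (2 * Real.pi : ℂ)⁻¹)).mul (h1.mul h2)
    exact h3.congr (Eventually.of_forall fun x => (hrep x).symm)
  -- At the point with β log y = m both the series and its integral representation are valid on a
  -- neighbourhood, which is enough for the identity theorem on (0, ∞).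
  set m := min l₀ (Real.log ρ) - 1 with hm
  have hev : ∀ᶠ y in 𝓝 (Real.exp (m / β)), f y = f₁ y := by
    have hcont : ContinuousAt (fun y => β * Real.log y) (Real.exp (m / β)) :=
      continuousAt_const.mul (Real.continuousAt_log (Real.exp_pos _).ne')
    have hlt : β * Real.log (Real.exp (m / β)) < min l₀ (Real.log ρ) := by
      rw [Real.log_exp, mul_div_cancel₀ _ hβ]; linarith
    filter_upwards [hcont.eventually (gt_mem_nhds hlt), lt_mem_nhds (Real.exp_pos (m / β))]
      with y hy hy0
    have hyβ : ∀ r : ℝ, y ^ (β * r) = Real.exp (β * Real.log y * r) := fun r => by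
      rw [Real.rpow_def_of_pos hy0]; ring_nf
    have h1 := hser y hy0 (by
      have := hyβ 1
      rw [mul_one, mul_one] at this
      rw [this, ← Real.lt_log_iff_exp_lt hρ]
      exact hy.trans_le (min_le_right _ _))
    refine hl₀ (β * Real.log y) (hy.trans_le (min_le_left _ _)) _ ?_
    convert h1 using 3 with n
    rw [hyβ]
    push_cast; rfl
  exact hfa.eqOn_of_preconnected_of_eventuallyEq hf₁a isPreconnected_Ioi
    (mem_Ioi.2 (Real.exp_pos (m / β))) hev (mem_Ioi.2 hx)

end

/-! ### The kernel on the line and logarithmic coordinates -/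

/-- Cauchy's estimate on a disc of fixed radius inside the strip transfers the decay to the
derivative, at the cost of e^{ηR}/R. -/
theorem exists_line_decay {F : ℂ → ℂ} {δ σ : ℝ} (hF : IsHardyClass δ F) (h0 : 0 < σ) (hσ : σ < δ) :
    ∃ η C, 0 < η ∧ ∀ t, ‖masterKernel F (vline σ t)‖ ≤ C * Real.exp (-η * |t|) ∧
      ‖deriv (masterKernel F) (vline σ t)‖ ≤ C * Real.exp (-η * |t|) := by
  obtain ⟨η, hη, hdec⟩ := exists_masterKernel_decay hF
  set R := min σ (δ - σ) / 2 with hR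
  have hm : 0 < min σ (δ - σ) := lt_min h0 (by linarith)
  have hR0 : 0 < R := by positivity
  have hRσ : R < σ := by linarith [min_le_left σ (δ - σ)]
  have hRδ : R < δ - σ := by linarith [min_le_right σ (δ - σ)]
  obtain ⟨C, hC⟩ := hdec (σ - R) (σ + R) (by linarith) (by linarith)
  have hC0 : 0 ≤ C := by
    have := (norm_nonneg _).trans (hC (vline σ 0) (by simp; linarith) (by simp; linarith))
    simpa using this
  refine ⟨η, max C (C * Real.exp (η * R) / R), hη, fun t => ⟨?_, ?_⟩⟩
  · have := hC (vline σ t) (by simp; linarith) (by simp; linarith)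
    rw [vline_im] at this
    refine this.trans ?_
    gcongr
    exact le_max_left _ _
  · have hball : ∀ z ∈ Metric.closedBall (vline σ t) R, σ - R ≤ z.re ∧ z.re ≤ σ + R ∧
        |t| - R ≤ |z.im| := by
      intro z hz
      rw [Metric.mem_closedBall, dist_eq_norm] at hz
      have h1 := (Complex.abs_re_le_norm _).trans hz
      have h2 := (Complex.abs_im_le_norm _).trans hz
      rw [Complex.sub_re, vline_re, abs_le] at h1
      rw [Complex.sub_im, vline_im, abs_sub_comm] at h2
      refine ⟨by linarith, by linarith, ?_⟩
      linarith [abs_sub_abs_le_abs_sub t z.im]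
    have hd : DifferentiableOn ℂ (masterKernel F) (Metric.closedBall (vline σ t) R) := fun z hz =>
      (differentiableAt_masterKernel hF.1 (by linarith [(hball z hz).1])
        (by linarith [(hball z hz).2.1])).differentiableWithinAt
    have := Complex.norm_deriv_le_of_forall_mem_sphere_norm_le (f := masterKernel F)
      (c := vline σ t) (C := C * (Real.exp (η * R) * Real.exp (-η * |t|))) hR0
      (DifferentiableOn.diffContOnCl_ball hd subset_rfl) (fun z hz => by
        have hb := hball z (Metric.sphere_subset_closedBall hz)
        refine (hC z hb.1 hb.2.1).trans ?_
        rw [← Real.exp_add]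
        gcongr
        nlinarith [hb.2.2])
    refine this.trans ?_
    calc _ = C * Real.exp (η * R) / R * Real.exp (-η * |t|) := by ring
      _ ≤ _ := by gcongr; exact le_max_right _ _

theorem integral_exp_comp (H : ℝ → ℂ) {a b : ℝ} (hab : a ≤ b) :
    ∫ x in Real.exp a..Real.exp b, H x = ∫ y in a..b, Real.exp y * H (Real.exp y) := by
  have himg : Real.exp '' Ioc a b = Ioc (Real.exp a) (Real.exp b) := by
    ext x
    simp only [mem_image, mem_Ioc]
    constructor
    · rintro ⟨y, ⟨h1, h2⟩, rfl⟩
      exact ⟨Real.exp_lt_exp.2 h1, Real.exp_le_exp.2 h2⟩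
    · rintro ⟨h1, h2⟩
      have hx : 0 < x := (Real.exp_pos a).trans h1
      exact ⟨Real.log x, ⟨(Real.lt_log_iff_exp_lt hx).2 h1, (Real.log_le_iff_le_exp hx).2 h2⟩,
        Real.exp_log hx⟩
  rw [intervalIntegral.integral_of_le (Real.exp_le_exp.2 hab), intervalIntegral.integral_of_le hab,
    ← himg, integral_image_eq_integral_abs_deriv_smul measurableSet_Ioc
      (fun x _ => (Real.hasDerivAt_exp x).hasDerivWithinAt) Real.exp_injective.injOn]
  refine integral_congr_ae (Eventually.of_forall fun y => ?_)
  simp [abs_of_pos (Real.exp_pos y)]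

theorem integral_Ioi_eq_integral_exp (H : ℝ → ℂ) :
    ∫ x in Ioi (0 : ℝ), H x = ∫ y, Real.exp y * H (Real.exp y) := by
  rw [← Real.range_exp, ← image_univ, integral_image_eq_integral_abs_deriv_smul MeasurableSet.univ
      (fun x _ => (Real.hasDerivAt_exp x).hasDerivWithinAt) Real.exp_injective.injOn,
    setIntegral_univ]
  refine integral_congr_ae (Eventually.of_forall fun y => ?_)
  simp [abs_of_pos (Real.exp_pos y)]

theorem integrableOn_Ioi_iff_integrable_exp (H : ℝ → ℂ) :
    IntegrableOn H (Ioi 0) ↔ Integrable fun y => (Real.exp y : ℂ) * H (Real.exp y) := by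
  rw [← Real.range_exp, ← image_univ, integrableOn_image_iff_integrableOn_abs_deriv_smul
      MeasurableSet.univ (fun x _ => (Real.hasDerivAt_exp x).hasDerivWithinAt)
      Real.exp_injective.injOn, integrableOn_univ]
  refine integrable_congr (Eventually.of_forall fun y => ?_)
  simp [abs_of_pos (Real.exp_pos y)]

theorem integral_symm_comp_mul (P : ℝ → ℂ) {a : ℝ} (ha : a ≠ 0) (r : ℝ) :
    ∫ y in (-r)..r, P (a * y) = ((|a|⁻¹ : ℝ) : ℂ) * ∫ z in (-(|a| * r))..(|a| * r), P z := by
  rw [intervalIntegral.integral_comp_mul_left _ ha, Complex.real_smul]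
  rcases lt_or_gt_of_ne ha with h | h
  · rw [abs_of_neg h, mul_neg, intervalIntegral.integral_symm, inv_neg]
    push_cast
    rw [neg_mul, neg_mul, neg_neg]
    ring
  · rw [abs_of_pos h, mul_neg]

theorem ofReal_cpow_eq_exp {x : ℝ} (hx : 0 < x) (s : ℂ) :
    (x : ℂ) ^ s = Complex.exp ((Real.log x : ℝ) * s) := by
  rw [Complex.cpow_def_of_ne_zero (by exact_mod_cast hx.ne'), Complex.ofReal_log hx.le]

section
variable {f g : ℝ → ℂ} {F φ : ℂ → ℂ} {α : ℂ} {β κ b c δ : ℝ}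

theorem line_argument_eq (hβ : β ≠ 0) (t : ℝ) :
    (α - κ * vline c t) / β = vline ((α.re - κ * c) / β) ((α.im - κ * t) / β) := by
  have : (β : ℂ) ≠ 0 := Complex.ofReal_ne_zero.2 hβ
  unfold vline
  push_cast
  field_simp
  linear_combination -Complex.re_add_im α

/-- Supplies the hypotheses on K in `conditional_parseval`: the affine substitution only rescales
the exponential decay rate by |κ/β| and shifts its centre. -/
theorem exists_kernel_regularity (hβ : β ≠ 0) (hκ : κ ≠ 0) (hF : IsHardyClass δ F)
    (hc : 0 < (α.re - κ * c) / β) (hc' : (α.re - κ * c) / β < δ) :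
    ∃ (K' : ℝ → ℂ) (D : ℝ),
      (∀ t, HasDerivAt (fun t => masterKernel F ((α - κ * vline c t) / β)) (K' t) t) ∧
      Continuous K' ∧
      (∀ t, ‖masterKernel F ((α - κ * vline c t) / β)‖ ≤ D * ((1 + t ^ 2) ^ 2)⁻¹) ∧
      ∀ t, ‖K' t‖ ≤ D * ((1 + t ^ 2) ^ 2)⁻¹ := by
  obtain ⟨η, C, hη, hC⟩ := exists_line_decay hF hc hc'
  set σ := (α.re - κ * c) / β with hσ
  set ω : ℂ := -(κ * Complex.I) / β with hω
  have hC0 : 0 ≤ C := by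
    have := (norm_nonneg _).trans (hC 0).1
    simpa using this
  set η' := η * (|κ| / |β|) with hη'
  have hη'0 : 0 < η' := by positivity
  have hexp : ∀ t : ℝ, Real.exp (-η * |(α.im - κ * t) / β|) ≤
      Real.exp (η * (|α.im| / |β|)) * ((2 + 48 / η' ^ 4) * ((1 + t ^ 2) ^ 2)⁻¹) := by
    intro t
    have h1 : |κ| / |β| * |t| - |α.im| / |β| ≤ |(α.im - κ * t) / β| := by
      rw [abs_div, div_mul_eq_mul_div, ← sub_div]
      gcongr
      rw [← abs_mul, abs_sub_comm]
      exact abs_sub_abs_le_abs_sub _ _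
    calc _ ≤ Real.exp (η * (|α.im| / |β|)) * Real.exp (-η' * |t|) := by
          rw [← Real.exp_add]
          gcongr
          rw [hη']
          nlinarith
      _ ≤ _ := by gcongr; exact exp_neg_mul_abs_le hη'0 t
  have hline : ∀ t, HasDerivAt (fun t : ℝ => (α - κ * vline c t) / β) ω t := by
    intro t
    have h1 : HasDerivAt (fun t : ℝ => (c : ℂ) + (t : ℂ) * Complex.I) (1 * Complex.I) t :=
      ((hasDerivAt_id t).ofReal_comp.mul_const Complex.I).const_add (c : ℂ)
    have h2 := ((h1.const_mul (κ : ℂ)).const_sub α).div_const (β : ℂ)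
    rw [one_mul] at h2
    exact h2
  have hopen : IsOpen {s : ℂ | 0 < s.re ∧ s.re < δ} :=
    (isOpen_lt continuous_const Complex.continuous_re).inter
      (isOpen_lt Complex.continuous_re continuous_const)
  have hdiff : DifferentiableOn ℂ (masterKernel F) {s : ℂ | 0 < s.re ∧ s.re < δ} := fun s hs =>
    (differentiableAt_masterKernel hF.1 hs.1 hs.2).differentiableWithinAt
  have hmem : ∀ t : ℝ, (α - κ * vline c t) / β ∈ {s : ℂ | 0 < s.re ∧ s.re < δ} := fun t => by
    rw [line_argument_eq hβ]; simpa using ⟨hc, hc'⟩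
  have hD : ∀ z : ℂ, ∀ t : ℝ, ‖z‖ ≤ C * Real.exp (-η * |(α.im - κ * t) / β|) →
      ‖z‖ ≤ C * (Real.exp (η * (|α.im| / |β|)) * (2 + 48 / η' ^ 4)) * ((1 + t ^ 2) ^ 2)⁻¹ := by
    intro z t hz
    calc _ ≤ C * (Real.exp (η * (|α.im| / |β|)) * ((2 + 48 / η' ^ 4) * ((1 + t ^ 2) ^ 2)⁻¹)) :=
          hz.trans (by gcongr; exact hexp t)
      _ = _ := by ring
  set D := C * (Real.exp (η * (|α.im| / |β|)) * (2 + 48 / η' ^ 4)) with hDdef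
  have hD0 : 0 ≤ D := by positivity
  refine ⟨fun t => deriv (masterKernel F) ((α - κ * vline c t) / β) * ω, D * max 1 ‖ω‖,
    fun t => ?_, ?_, fun t => ?_, fun t => ?_⟩
  · have h := (hdiff.differentiableAt (hopen.mem_nhds (hmem t))).hasDerivAt
    exact HasDerivAt.comp t (h₂ := masterKernel F) (h := fun t : ℝ => (α - κ * vline c t) / β) h
      (hline t)
  · refine Continuous.mul ?_ continuous_const
    exact (hdiff.deriv hopen).continuousOn.comp_continuous (by fun_prop) hmem
  · rw [line_argument_eq hβ]
    refine (hD _ t (hC _).1).trans ?_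
    gcongr
    exact le_mul_of_one_le_right hD0 (le_max_left _ _)
  · rw [norm_mul, line_argument_eq hβ]
    calc _ ≤ (D * ((1 + t ^ 2) ^ 2)⁻¹) * max 1 ‖ω‖ := by
          gcongr
          · exact hD _ t (hC _).2
          · exact le_max_right _ _
      _ = _ := by ring

/-- The line σ is the one for which e^{αy} combines with e^{-βyw} into e^{κ(c+it)y}. The factor
|κ|/|β| is the Jacobian of τ = (Im α - κt)/β. -/
theorem cexp_mul_comp_exp (hβ : β ≠ 0) (hκ : κ ≠ 0) (hF : IsHardyClass δ F)
    (hf : HasIndicatorExpansion f F β)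
    (hc : 0 < (α.re - κ * c) / β) (hc' : (α.re - κ * c) / β < δ) (y : ℝ) :
    Complex.exp (α * y) * f (Real.exp y) = (2 * Real.pi : ℂ)⁻¹ * ((|κ| / |β| : ℝ) : ℂ) *
      Complex.exp (κ * c * y) *
      ∫ t, masterKernel F ((α - κ * vline c t) / β) * osc t (κ / (2 * Real.pi) * y) := by
  have hβ' : (β : ℂ) ≠ 0 := Complex.ofReal_ne_zero.2 hβ
  rw [eq_integral_masterKernel hβ hF hf hc hc' (Real.exp_pos y), Real.log_exp]
  set σ := (α.re - κ * c) / β with hσ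
  set u : ℝ → ℂ := fun τ => masterKernel F (vline σ τ) * Complex.exp (-((β * y : ℝ) * vline σ τ))
    with hu
  have hsub : ∫ τ, u τ = ((|κ| / |β| : ℝ) : ℂ) * ∫ t, u ((α.im - κ * t) / β) := by
    have h1 := Measure.integral_comp_mul_left (fun τ => u (α.im / β - τ)) (κ / β)
    rw [integral_sub_left_eq_self u volume (α.im / β), Complex.real_smul] at h1
    have e : ∀ t, u ((α.im - κ * t) / β) = u (α.im / β - κ / β * t) := fun t => by
      congr 1; field_simp
    simp_rw [e]
    rw [h1, ← mul_assoc, ← Complex.ofReal_mul, abs_inv, abs_div, mul_inv_cancel₀, Complex.ofReal_one,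
      one_mul]
    positivity
  rw [hsub]
  have hint : ∀ t : ℝ, Complex.exp (α * y) * u ((α.im - κ * t) / β) = Complex.exp (κ * c * y) *
      (masterKernel F ((α - κ * vline c t) / β) * osc t (κ / (2 * Real.pi) * y)) := by
    intro t
    simp only [hu]
    rw [hσ, ← line_argument_eq hβ, mul_left_comm, ← Complex.exp_add, mul_left_comm (Complex.exp _)]
    unfold osc
    rw [← Complex.exp_add]
    congr 2
    unfold vline
    have hpi : (Real.pi : ℂ) ≠ 0 := Complex.ofReal_ne_zero.2 Real.pi_ne_zero
    push_cast
    field_simp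
    ring
  have : Complex.exp (α * y) * ∫ t, u ((α.im - κ * t) / β) = Complex.exp (κ * c * y) *
      ∫ t, masterKernel F ((α - κ * vline c t) / β) * osc t (κ / (2 * Real.pi) * y) := by
    rw [← integral_const_mul, ← integral_const_mul]
    exact integral_congr_ae (Eventually.of_forall hint)
  linear_combination (2 * Real.pi : ℂ)⁻¹ * ((|κ| / |β| : ℝ) : ℂ) * this

theorem truncLineIntegral_eq (h : ℂ → ℂ) (T : ℝ) :
    truncLineIntegral c h T = (2 * Real.pi : ℂ)⁻¹ * ∫ t in (-T)..T, h (vline c t) := by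
  unfold truncLineIntegral
  rw [intervalIntegral.integral_mul_const]
  have hpi : (Real.pi : ℂ) ≠ 0 := Complex.ofReal_ne_zero.2 Real.pi_ne_zero
  change _ * ((∫ t in (-T)..T, h (vline c t)) * Complex.I) = _
  field_simp

/-- With x = b e^y and 2πz = κy, the factor x^{-κs} splits into b^{-κs}, a pure oscillation in t,
and a real weight independent of t. -/
theorem cpow_scaled_exp (hκ : κ ≠ 0) (hb : 0 < b) (z t : ℝ) :
    ((b * Real.exp (2 * Real.pi / κ * z) : ℝ) : ℂ) ^ (-((κ : ℂ) * vline c t)) =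
      (b : ℂ) ^ (-((κ : ℂ) * vline c t)) * osc (-t) z *
        ((Real.exp (-(2 * Real.pi * c * z)) : ℝ) : ℂ) := by
  have hκ' : (κ : ℂ) ≠ 0 := Complex.ofReal_ne_zero.2 hκ
  rw [ofReal_cpow_eq_exp (by positivity), ofReal_cpow_eq_exp hb,
    Real.log_mul hb.ne' (Real.exp_pos _).ne', Real.log_exp, Complex.ofReal_exp]
  unfold osc
  rw [← Complex.exp_add, ← Complex.exp_add]
  congr 1
  unfold vline
  push_cast
  field_simp
  ring

theorem locallyIntegrable_of_isScaledInverseMellin (hg : IsScaledInverseMellin g φ κ c) :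
    LocallyIntegrable fun t => φ (vline c t) := by
  have := (hg.1 1 one_pos).1
  simpa [vline] using this

end

/-! ### Assembly of the theorem -/

section
variable {f g : ℝ → ℂ} {F φ : ℂ → ℂ} {α : ℂ} {β κ b c δ : ℝ}

theorem mellin_barnes_integrand_eq (s : ℂ) :
    φ s * Complex.Gamma ((α - κ * s) / β) * F ((κ * s - α) / β) * (b : ℂ) ^ (-((κ : ℂ) * s)) =
      φ s * (b : ℂ) ^ (-((κ : ℂ) * s)) * masterKernel F ((α - κ * s) / β) := by
  have : (κ * s - α) / β = -((α - κ * s) / β) := by ring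
  rw [this]; unfold masterKernel; ring

theorem continuous_cpow_vline (hb : 0 < b) :
    Continuous fun t => (b : ℂ) ^ (-((κ : ℂ) * vline c t)) := by
  simp_rw [ofReal_cpow_eq_exp hb]; fun_prop

/-- The two integrals of the theorem in logarithmic coordinates: convergence of the Mellin–Barnes
integral, and its value when the other integral converges symmetrically. -/
theorem exists_line_integral_limit (hβ : β ≠ 0) (hκ : κ ≠ 0) (hb : 0 < b)
    (hF : IsHardyClass δ F) (hf : HasIndicatorExpansion f F β) (hg : IsScaledInverseMellin g φ κ c)
    (hc : 0 < (α.re - κ * c) / β) (hc' : (α.re - κ * c) / β < δ) :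
    ∃ J : ℂ, HasLineIntegral c
        (fun s => φ s * Complex.Gamma ((α - κ * s) / β) * F ((κ * s - α) / β) *
          (b : ℂ) ^ (-((κ : ℂ) * s))) J ∧
      AEStronglyMeasurable (fun y : ℝ => Complex.exp (α * y) * f (Real.exp y) * g (b * Real.exp y)) ∧
      ∀ L : ℂ, Tendsto (fun r : ℝ => ∫ y in (-r)..r,
          Complex.exp (α * y) * f (Real.exp y) * g (b * Real.exp y)) atTop (𝓝 L) →
        L = 1 / ((|β| : ℝ) : ℂ) * J := by
  obtain ⟨K', D, hK, hK', hd, hd'⟩ := exists_kernel_regularity hβ hκ hF hc hc'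
  have hφ := locallyIntegrable_of_isScaledInverseMellin hg
  set K : ℝ → ℂ := fun t => masterKernel F ((α - κ * vline c t) / β) with hKdef
  have hKc : Continuous K := continuous_iff_continuousAt.2 fun t => (hK t).continuousAt
  set h : ℝ → ℂ := fun t => φ (vline c t) * (b : ℂ) ^ (-((κ : ℂ) * vline c t)) with hh
  have hhl : LocallyIntegrable h := hφ.mul_continuous (continuous_cpow_vline hb)
  set X : ℝ → ℝ := fun z => b * Real.exp (2 * Real.pi / κ * z) with hX
  have hX0 : ∀ z, 0 < X z := fun z => by positivity
  have hpi : (Real.pi : ℂ) ≠ 0 := Complex.ofReal_ne_zero.2 Real.pi_ne_zero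
  have hβ' : ((|β| : ℝ) : ℂ) ≠ 0 := Complex.ofReal_ne_zero.2 (abs_ne_zero.2 hβ)
  have hκ' : ((|κ| : ℝ) : ℂ) ≠ 0 := Complex.ofReal_ne_zero.2 (abs_ne_zero.2 hκ)
  have hκ0 : (κ : ℂ) ≠ 0 := Complex.ofReal_ne_zero.2 hκ
  -- This weight equals e^{κcy}. It is the factor produced on the f side, and it cancels the weight
  -- e^{-2πcz} of g, so that G is an unweighted Fourier integral of h.
  set e : ℝ → ℂ := fun z => ((Real.exp (2 * Real.pi * c * z) : ℝ) : ℂ) with he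
  have hS : ∀ z T, ∫ t in (-T)..T, h t * osc (-t) z = 2 * Real.pi * e z *
      truncLineIntegral c (fun s => φ s * (X z : ℂ) ^ (-((κ : ℂ) * s))) T := by
    intro z T
    rw [truncLineIntegral_eq]
    have e1 : ∀ t, φ (vline c t) * (X z : ℂ) ^ (-((κ : ℂ) * vline c t)) =
        (h t * osc (-t) z) * ((Real.exp (-(2 * Real.pi * c * z)) : ℝ) : ℂ) := fun t => by
      simp only [hX]
      rw [cpow_scaled_exp hκ hb]; simp only [hh]; ring
    simp_rw [e1]
    rw [intervalIntegral.integral_mul_const]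
    have e2 : e z * ((Real.exp (-(2 * Real.pi * c * z)) : ℝ) : ℂ) = 1 := by
      simp only [he]
      rw [← Complex.ofReal_mul, ← Real.exp_add]; simp
    have e3 : (2 * Real.pi : ℂ) * (2 * Real.pi : ℂ)⁻¹ = 1 := mul_inv_cancel₀ (by simp [hpi])
    linear_combination (-(∫ t in (-T)..T, h t * osc (-t) z)) * (e2 + e3 *
      (e z * ((Real.exp (-(2 * Real.pi * c * z)) : ℝ) : ℂ)))
  set G : ℝ → ℂ := fun z => 2 * Real.pi * e z * g (X z) with hGdef
  have hG : ∀ z, Tendsto (fun T : ℝ => ∫ t in (-T)..T, h t * osc (-t) z) atTop (𝓝 (G z)) := by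
    intro z
    simp_rw [hS]
    exact (hg.1 (X z) (hX0 z)).2.const_mul _
  have hB : ∀ Y, ∃ B, ∀ z, |z| ≤ Y → ∀ T : ℝ, 0 ≤ T →
      ‖∫ t in (-T)..T, h t * osc (-t) z‖ ≤ B := by
    intro Y
    set M := |2 * Real.pi / κ| * Y with hM
    obtain ⟨B, hB⟩ := hg.2 (b * Real.exp (-M)) (b * Real.exp M) (by positivity)
    refine ⟨2 * Real.pi * Real.exp (|2 * Real.pi * c| * Y) * B, fun z hz T hT => ?_⟩
    have hz1 : |2 * Real.pi / κ * z| ≤ M := by rw [abs_mul, hM]; gcongr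
    have hz2 : 2 * Real.pi * c * z ≤ |2 * Real.pi * c| * Y := by
      refine (le_abs_self _).trans ?_
      rw [abs_mul]; gcongr
    have hz3 := abs_le.1 hz1
    rw [hS, norm_mul, norm_mul]
    have n1 : ‖(2 * Real.pi : ℂ)‖ = 2 * Real.pi := by
      simp [abs_of_pos Real.pi_pos]
    have n2 : ‖e z‖ ≤ Real.exp (|2 * Real.pi * c| * Y) := by
      simp only [he]
      rw [Complex.norm_real, Real.norm_of_nonneg (Real.exp_pos _).le]
      gcongr
    rw [n1]
    gcongr
    exact hB (X z) ⟨by simp only [hX]; gcongr; exact hz3.1, by simp only [hX]; gcongr; exact hz3.2⟩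
      T hT
  obtain ⟨J₀, hJ₀, hloc, hval⟩ := conditional_parseval hhl hK hK' hd hd' hG hB
  set P : ℝ → ℂ := fun z => (∫ τ, K τ * osc τ z) * G z with hP
  set a : ℝ := κ / (2 * Real.pi) with ha
  have ha0 : a ≠ 0 := by rw [ha]; have := Real.pi_pos; positivity
  set c₀ : ℂ := (2 * Real.pi : ℂ)⁻¹ * (2 * Real.pi : ℂ)⁻¹ * ((|κ| / |β| : ℝ) : ℂ) with hc₀
  have hE : ∀ y : ℝ, Complex.exp (α * y) * f (Real.exp y) * g (b * Real.exp y) =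
      c₀ * P (a * y) := by
    intro y
    rw [cexp_mul_comp_exp hβ hκ hF hf hc hc']
    have e1 : X (a * y) = b * Real.exp y := by
      simp only [hX, ha]; congr 2; field_simp
    have e2 : e (a * y) = Complex.exp (κ * c * y) := by
      simp only [he, ha]
      rw [Complex.ofReal_exp]; congr 1; push_cast; field_simp
    simp only [hP, hGdef, e1, e2, hc₀]
    have e3 : (2 * Real.pi : ℂ) * (2 * Real.pi : ℂ)⁻¹ = 1 := mul_inv_cancel₀ (by simp [hpi])
    linear_combination (-((2 * Real.pi : ℂ)⁻¹ * ((|κ| / |β| : ℝ) : ℂ) * Complex.exp (κ * c * y) *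
      (∫ t, K t * osc t (a * y)) * g (b * Real.exp y))) * e3
  refine ⟨(2 * Real.pi : ℂ)⁻¹ * J₀, ⟨?_, ?_⟩, ?_, fun L hL => ?_⟩
  · have : LocallyIntegrable fun t => h t * K t := hhl.mul_continuous hKc
    refine this.congr (Eventually.of_forall fun t => ?_)
    exact (mellin_barnes_integrand_eq (vline c t)).symm
  · refine (hJ₀.const_mul _).congr fun T => ?_
    rw [truncLineIntegral_eq]
    simp_rw [mellin_barnes_integrand_eq]
    rfl
  · simp_rw [hE]
    refine AEStronglyMeasurable.const_mul ?_ _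
    refine hloc.aestronglyMeasurable.comp_quasiMeasurePreserving
      ⟨measurable_const_mul a, ?_⟩
    rw [Real.map_volume_mul_left ha0]
    exact Measure.smul_absolutelyContinuous
  · simp_rw [hE] at hL
    have h1 : ∀ r : ℝ, ∫ y in (-r)..r, c₀ * P (a * y) =
        c₀ * ((|a|⁻¹ : ℝ) : ℂ) * ∫ z in (-(|a| * r))..(|a| * r), P z := fun r => by
      rw [intervalIntegral.integral_const_mul, integral_symm_comp_mul P ha0, mul_assoc c₀]
    simp_rw [h1] at hL
    -- The Jacobian 2π/|κ| of z = κy/(2π) cancels |κ| and one factor 2π, leaving the 1/|β| of the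
    -- statement and the 1/(2π) of the line integral.
    have h2 : c₀ * ((|a|⁻¹ : ℝ) : ℂ) = (2 * Real.pi : ℂ)⁻¹ * ((|β| : ℝ) : ℂ)⁻¹ := by
      rw [hc₀, ha, abs_div, abs_of_pos Real.two_pi_pos]
      push_cast
      field_simp
    rw [h2] at hL
    have hne : (2 * Real.pi : ℂ)⁻¹ * ((|β| : ℝ) : ℂ)⁻¹ ≠ 0 :=
      mul_ne_zero (inv_ne_zero (by simp [hpi])) (inv_ne_zero hβ')
    have h3 : Tendsto (fun r : ℝ => r / |a|) atTop atTop :=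
      tendsto_id.atTop_div_const (abs_pos.2 ha0)
    have h4 := (hL.comp h3).const_mul ((2 * Real.pi : ℂ)⁻¹ * ((|β| : ℝ) : ℂ)⁻¹)⁻¹
    have h5 := hval _ (h4.congr fun r => by
      simp only [Function.comp_apply]
      rw [inv_mul_cancel_left₀ hne, mul_div_cancel₀ _ (abs_ne_zero.2 ha0)])
    rw [inv_mul_eq_iff_eq_mul₀ hne] at h5
    rw [h5]; ring

theorem exp_mul_integrand_eq (y : ℝ) :
    (Real.exp y : ℂ) * (((Real.exp y : ℝ) : ℂ) ^ (α - 1) * f (Real.exp y) * g (b * Real.exp y)) =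
      Complex.exp (α * y) * f (Real.exp y) * g (b * Real.exp y) := by
  rw [ofReal_cpow_eq_exp (Real.exp_pos y), Real.log_exp, ← mul_assoc, ← mul_assoc,
    Complex.ofReal_exp, ← Complex.exp_add]
  congr 3
  ring_nf

end

section
variable {f g : ℝ → ℂ} {F φ : ℂ → ℂ} {α : ℂ} {β κ b c δ : ℝ}

/-- The formula for f holds on the lines σ + R and σ - R as well. Choosing between them by the sign
of βy gains e^{-|β|R|y|} at both ends. -/
theorem exists_cexp_mul_comp_exp_bound (hβ : β ≠ 0) (hF : IsHardyClass δ F)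
    (hf : HasIndicatorExpansion f F β)
    (hc : 0 < (α.re - κ * c) / β) (hc' : (α.re - κ * c) / β < δ) :
    ∃ C r : ℝ, 0 < r ∧ ∀ y : ℝ, ‖Complex.exp (α * y) * f (Real.exp y)‖ ≤
      C * Real.exp (κ * c * y) * Real.exp (-r * |y|) := by
  set σ := (α.re - κ * c) / β with hσ
  have hα : α.re = β * σ + κ * c := by rw [hσ]; field_simp; ring
  set R := min σ (δ - σ) / 2 with hR
  have hm : 0 < min σ (δ - σ) := lt_min hc (by linarith)
  have hR0 : 0 < R := by positivity
  have hRσ : R < σ := by linarith [min_le_left σ (δ - σ)]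
  have hRδ : R < δ - σ := by linarith [min_le_right σ (δ - σ)]
  set M : ℝ → ℝ := fun σ' => (2 * Real.pi)⁻¹ * ∫ t, ‖masterKernel F (vline σ' t)‖ with hM
  have hbound : ∀ σ', 0 < σ' → σ' < δ → ∀ y : ℝ,
      ‖f (Real.exp y)‖ ≤ M σ' * Real.exp (-(β * y) * σ') := by
    intro σ' h1 h2 y
    rw [eq_integral_masterKernel hβ hF hf h1 h2 (Real.exp_pos y), Real.log_exp, norm_mul]
    have n1 : ‖(2 * Real.pi : ℂ)⁻¹‖ = (2 * Real.pi)⁻¹ := by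
      simp [abs_of_pos Real.pi_pos]
    rw [n1, hM, mul_assoc, ← integral_mul_const]
    gcongr
    refine (norm_integral_le_integral_norm _).trans (le_of_eq ?_)
    refine integral_congr_ae (Eventually.of_forall fun t => ?_)
    simp only
    rw [norm_mul, norm_cexp_neg_mul, vline_re]
  refine ⟨max (M (σ + R)) (M (σ - R)), |β| * R, by positivity, fun y => ?_⟩
  have n2 : ‖Complex.exp (α * y)‖ = Real.exp (α.re * y) := by rw [Complex.norm_exp]; simp
  rw [norm_mul, n2]
  have key : ∀ σ', 0 < σ' → σ' < δ → M σ' ≤ max (M (σ + R)) (M (σ - R)) →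
      β * y * (σ - σ') = -(|β| * R) * |y| → Real.exp (α.re * y) * ‖f (Real.exp y)‖ ≤
        max (M (σ + R)) (M (σ - R)) * Real.exp (κ * c * y) * Real.exp (-(|β| * R) * |y|) := by
    intro σ' h1 h2 h3 h4
    calc _ ≤ Real.exp (α.re * y) * (M σ' * Real.exp (-(β * y) * σ')) := by
          gcongr; exact hbound σ' h1 h2 y
      _ = M σ' * Real.exp (κ * c * y) * Real.exp (-(|β| * R) * |y|) := by
          rw [mul_left_comm, ← Real.exp_add, mul_assoc (M σ'), ← Real.exp_add, ← h4, hα]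
          ring_nf
      _ ≤ _ := by gcongr
  have habs : |β| * R * |y| = |β * y| * R := by rw [abs_mul]; ring
  rcases le_total 0 (β * y) with hy | hy
  · refine key (σ + R) (by linarith) (by linarith) (le_max_left _ _) ?_
    rw [neg_mul, habs, abs_of_nonneg hy]; ring
  · refine key (σ - R) (by linarith) (by linarith) (le_max_right _ _) ?_
    rw [neg_mul, habs, abs_of_nonpos hy]; ring

/-- The size of x^{-κs} is constant along the line. The resulting x^{-κc} cancels the growth e^{κcy}
allowed on the f side. -/
theorem norm_le_of_integrable (hg : IsScaledInverseMellin g φ κ c)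
    (hφ : Integrable fun t => φ (vline c t)) {x : ℝ} (hx : 0 < x) :
    ‖g x‖ ≤ (2 * Real.pi)⁻¹ * (∫ t, ‖φ (vline c t)‖) * Real.exp (-(κ * c * Real.log x)) := by
  have hn : ∀ t, ‖φ (vline c t) * (x : ℂ) ^ (-((κ : ℂ) * vline c t))‖ =
      ‖φ (vline c t)‖ * Real.exp (-(κ * c * Real.log x)) := fun t => by
    rw [norm_mul, ofReal_cpow_eq_exp hx, Complex.norm_exp]
    congr 2
    simp
    ring
  have n1 : ‖(2 * Real.pi : ℂ)⁻¹‖ = (2 * Real.pi)⁻¹ := by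
    simp [abs_of_pos Real.pi_pos]
  refine le_of_tendsto (hg.1 x hx).2.norm ((eventually_ge_atTop 0).mono fun T hT => ?_)
  rw [truncLineIntegral_eq, norm_mul, n1, mul_assoc]
  gcongr
  rw [← integral_mul_const]
  refine (intervalIntegral.norm_integral_le_integral_norm (by linarith)).trans ?_
  simp_rw [hn]
  rw [intervalIntegral.integral_of_le (by linarith)]
  exact setIntegral_le_integral (hφ.norm.mul_const _) (Eventually.of_forall fun t => by positivity)

end

theorem mainTheorem3 (f g : ℝ → ℂ) (F φ : ℂ → ℂ) (α : ℂ) (β κ b c δ : ℝ)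
    (hβ : β ≠ 0) (hκ : κ ≠ 0) (hb : 0 < b)
    (hF : IsHardyClass δ F)
    (hf : HasIndicatorExpansion f F β)
    (hg : IsScaledInverseMellin g φ κ c)
    (hc : 0 < (α.re - κ * c) / β) (hc' : (α.re - κ * c) / β < δ) :
    (∃ J : ℂ,
      HasLineIntegral c
        (fun s => φ s * Complex.Gamma ((α - κ * s) / β) * F ((κ * s - α) / β) *
          (b : ℂ) ^ (-((κ : ℂ) * s))) J ∧
      ∀ L : ℂ, HasHalfLineIntegral (fun x => (x : ℂ) ^ (α - 1) * f x * g (b * x)) L →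
        L = 1 / ((|β| : ℝ) : ℂ) * J) ∧
    (Integrable (fun t : ℝ => φ ((c : ℂ) + (t : ℂ) * Complex.I)) →
      IntegrableOn (fun x : ℝ => (x : ℂ) ^ (α - 1) * f x * g (b * x)) (Ioi 0) ∧
      Integrable (fun t : ℝ =>
        (fun s : ℂ => φ s * Complex.Gamma ((α - κ * s) / β) * F ((κ * s - α) / β) *
          (b : ℂ) ^ (-((κ : ℂ) * s))) ((c : ℂ) + (t : ℂ) * Complex.I)) ∧
      ∫ x in Ioi (0 : ℝ), (x : ℂ) ^ (α - 1) * f x * g (b * x) =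
        1 / ((|β| : ℝ) : ℂ) * (1 / (2 * (Real.pi : ℂ) * Complex.I) *
          ∫ t : ℝ, (fun s : ℂ => φ s * Complex.Gamma ((α - κ * s) / β) * F ((κ * s - α) / β) *
            (b : ℂ) ^ (-((κ : ℂ) * s))) ((c : ℂ) + (t : ℂ) * Complex.I) * Complex.I)) := by
  obtain ⟨J, hJ, hm, hval⟩ := exists_line_integral_limit hβ hκ hb hF hf hg hc hc'
  refine ⟨⟨J, hJ, fun L hL => hval L ?_⟩, fun hφ => ?_⟩
  -- Convergence with independent endpoints is used only along p = e^{-r}, q = e^r, which is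
  -- symmetric in y.
  · have hpair : Tendsto (fun r : ℝ => (Real.exp (-r), Real.exp r)) atTop
        (𝓝[>] (0 : ℝ) ×ˢ atTop) := by
      refine Tendsto.prodMk ?_ Real.tendsto_exp_atTop
      exact Real.tendsto_exp_atBot_nhdsGT.comp tendsto_neg_atTop_atBot
    refine (hL.2.comp hpair).congr' ?_
    filter_upwards [eventually_ge_atTop 0] with r hr
    simp only [Function.comp_apply]
    rw [integral_exp_comp _ (by linarith : -r ≤ r)]
    simp_rw [exp_mul_integrand_eq]
  · obtain ⟨C, r, hr, hC⟩ := exists_cexp_mul_comp_exp_bound (κ := κ) (c := c) hβ hF hf hc hc'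
    have hE : Integrable fun y : ℝ => Complex.exp (α * y) * f (Real.exp y) * g (b * Real.exp y) := by
      set M := (2 * Real.pi)⁻¹ * ∫ t, ‖φ (vline c t)‖ with hM
      have hM0 : 0 ≤ M := mul_nonneg (by positivity) (integral_nonneg fun _ => norm_nonneg _)
      refine ((integrable_exp_neg_mul_abs hr).const_mul
        (C * (M * Real.exp (-(κ * c * Real.log b))))).mono' hm (Eventually.of_forall fun y => ?_)
      rw [norm_mul]
      have h1 := norm_le_of_integrable hg hφ (x := b * Real.exp y) (by positivity)
      rw [Real.log_mul hb.ne' (Real.exp_pos y).ne', Real.log_exp] at h1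
      calc _ ≤ (C * Real.exp (κ * c * y) * Real.exp (-r * |y|)) *
            (M * Real.exp (-(κ * c * (Real.log b + y)))) :=
          mul_le_mul (hC y) h1 (norm_nonneg _) ((norm_nonneg _).trans (hC y))
        _ = C * M * Real.exp (-r * |y|) *
            (Real.exp (κ * c * y) * Real.exp (-(κ * c * (Real.log b + y)))) := by ring
        _ = _ := by
          rw [← Real.exp_add]
          ring_nf
    have hI : Integrable fun t => φ (vline c t) * Complex.Gamma ((α - κ * vline c t) / β) *
        F ((κ * vline c t - α) / β) * (b : ℂ) ^ (-((κ : ℂ) * vline c t)) := by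
      obtain ⟨K', D, hK, -, hd, -⟩ := exists_kernel_regularity hβ hκ hF hc hc'
      have hKc : Continuous fun t => masterKernel F ((α - κ * vline c t) / β) :=
        continuous_iff_continuousAt.2 fun t => (hK t).continuousAt
      simp_rw [mellin_barnes_integrand_eq]
      have h1 : Integrable fun t => φ (vline c t) * (b : ℂ) ^ (-((κ : ℂ) * vline c t)) := by
        refine Integrable.mul_bdd (c := b ^ (-(κ * c))) hφ
          (continuous_cpow_vline hb).aestronglyMeasurable (Eventually.of_forall fun t => ?_)
        rw [Complex.norm_cpow_eq_rpow_re_of_pos hb]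
        simp
      exact h1.mul_bdd hKc.aestronglyMeasurable (Eventually.of_forall (norm_le_const_of_decay hd))
    refine ⟨?_, hI, ?_⟩
    · rw [integrableOn_Ioi_iff_integrable_exp]
      simp_rw [exp_mul_integrand_eq]
      exact hE
    · rw [integral_Ioi_eq_integral_exp]
      simp_rw [exp_mul_integrand_eq]
      -- An absolutely convergent integral is also a limit of symmetric truncations, so the
      -- conditional identity gives its value; uniqueness of limits then identifies J with the
      -- absolute line integral.
      rw [hval _ (intervalIntegral_tendsto_integral hE tendsto_neg_atTop_atBot tendsto_id)]
      congr 1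
      refine tendsto_nhds_unique hJ.2 ?_
      refine (intervalIntegral_tendsto_integral (hI.mul_const Complex.I) tendsto_neg_atTop_atBot
        tendsto_id).const_mul _
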